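/- **Setting.** Let $X$ be a finite non-empty set, $M_X$ the algebra of complex $X\times X$ matrices with matrix units $\epsilon_{x,x'}$, $M_{XX}=M_X\otimes M_X$, $\mathcal P_{XX}$ the lattice of projections of $M_{XX}$, and $J_X=\frac1{|X|}\sum_{x,x'\in X}\epsilon_{x,x'}\otimes\epsilon_{x,x'}\in\mathcal P_{XX}$. A *quantum game* is a join-preserving map $\varphi:\mathcal P_{XX}\to\mathcal P_{XX}$ with $\varphi(0)=0$; it is *concurrent* if $\varphi(J_X)=J_X$. The *concurrency game* is the concurrent game $\varphi_0$ with $\varphi_0(0)=0$, $\varphi_0(J_X)=J_X$ and $\varphi_0(P)=1$ for all other $P\in\mathcal P_{XX}$. A *QNS correlation* is a completely positive trace preserving map $\Gamma:M_{XX}\to M_{XX}$ such that the partial trace of $\Gamma(\rho\otimes\sigma)$ over the first (resp. second) factor vanishes whenever $\operatorname{Tr}\rho=0$ (resp. $\operatorname{Tr}\sigma=0$). It is a *perfect strategy* for $\varphi$ if $\operatorname{Tr}\big(\Gamma(P)(1-\varphi(P))\big)=0$ for all $P\in\mathcal P_{XX}$. A *stochastic operator matrix* on a Hilbert space $H$ is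 a positive block operator matrix $E=(E_{x,x',a,a'})$, with rows indexed by $(x,a)$, columns by $(x',a')$ ($x,x',a,a'\in X$) and entries in $\mathcal B(H)$, such that $\sum_a E_{x,x',a,a}=\delta_{x,x'}1$. A QNS correlation $\Gamma$ is *quantum commuting* if there are a Hilbert space $H$, a unit vector $\xi\in H$ and stochastic operator matrices $E,F$ on $H$ with $E_{x,x',a,a'}F_{y,y',b,b'}=F_{y,y',b,b'}E_{x,x',a,a'}$ for all indices and $$\Gamma(\epsilon_{x,x'}\otimes\epsilon_{y,y'})=\sum_{a,a',b,b'}\langle E_{x,x',a,a'}F_{y,y',b,b'}\xi,\xi\rangle\,\epsilon_{a,a'}\otimes\epsilon_{b,b'}\qquad(x,x',y,y'\in X).$$ It is *local* ($\Gamma\in\mathcal Q_{\rm loc}$) if moreover the entries of $E$ pairwise commute and the entries of $F$ pairwise commute, and *quantum* ($\Gamma\in\mathcal Q_{\rm q}$) if it has such a form with $H=H_1\otimes H_2$, $H_1,H_2$ finite dimensional, and with $E_{x,x',a,a'}\otimes F_{y,y',b,b'}$ in place of $E_{x,x',a,a'}F_{y,y',b,b'}$, where $E$ acts on $H_1$ and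 $F$ on $H_2$. Let $\mathcal B_X$ (the Brown algebra) be the universal unital C*-algebra generated by the entries $u_{a,x}$ of a unitary matrix $(u_{a,x})_{a,x\in X}$, let $p_{x,x',a,a'}=u_{a,x}^*u_{a',x'}$, and let $\mathcal C_X\subseteq\mathcal B_X$ be the C*-subalgebra generated by all $p_{x,x',a,a'}$. **Theorem.** Let $\Gamma:M_{XX}\to M_{XX}$ be a quantum commuting QNS correlation. Then $\Gamma$ is a perfect strategy for some concurrent game if and only if there exists a tracial state $\tau:\mathcal C_X\to\mathbb C$ such that $$\Gamma(\epsilon_{x,x'}\otimes\epsilon_{y,y'})=\sum_{a,a',b,b'\in X}\tau(p_{x,x',a,a'}\,p_{y',y,b',b})\,\epsilon_{a,a'}\otimes\epsilon_{b,b'},\qquad x,x',y,y'\in X,\tag{$*$}$$ and this is also equivalent to $\Gamma$ being a perfect strategy for the concurrency game $\varphi_0$. Moreover, if $\Gamma$ is a perfect strategy for a concurrent game $\varphi$ (any one), then 1. $\Gamma\in\mathcal Q_{\rm q}$ if and only if there is a tracial state $\tau$ of $\mathcal C_X$ satisfying $(*)$ that factors through a finite dimensional *-representation of $\mathcal C_X$;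 2. $\Gamma\in\mathcal Q_{\rm loc}$ if and only if there is a tracial state $\tau$ of $\mathcal C_X$ satisfying $(*)$ that factors through an abelian *-representation of $\mathcal C_X$ (one with commutative range). -/

import Mathlib

open scoped Matrix Kronecker ComplexOrder ENNReal CStarAlgebra

noncomputable section

namespace QNS

/-! ### Quantum channels and quantum no-signalling correlations

`M_X` is `Matrix X X ℂ`, and `M_{XY} = M_X ⊗ M_Y` is `Matrix (X × Y) (X × Y) ℂ`. Hilbert spaces
range over `Type`; as only countably many operators are involved, larger universes would give the
same classes. -/

/-- The matrix unit `ε_{x,x'}` of `M_X`. -/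
def eps {X : Type} [DecidableEq X] (x x' : X) : Matrix X X ℂ := Matrix.single x x' 1

/-- Partial trace over the first tensor factor, `Tr_A : M_{AB} → M_B`. -/
def trFst {A B : Type} [Fintype A] (M : Matrix (A × B) (A × B) ℂ) : Matrix B B ℂ :=
  Matrix.of fun b b' => ∑ a, M (a, b) (a, b')

/-- Partial trace over the second tensor factor, `Tr_B : M_{AB} → M_A`. -/
def trSnd {A B : Type} [Fintype B] (M : Matrix (A × B) (A × B) ℂ) : Matrix A A ℂ :=
  Matrix.of fun a a' => ∑ b, M (a, b) (a', b)

/-- Complete positivity: every amplification `id_n ⊗ Φ : M_n ⊗ M_I → M_n ⊗ M_K` is positive. -/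
def IsCompletelyPositive {I K : Type} [Fintype I] [Fintype K]
    (Φ : Matrix I I ℂ →ₗ[ℂ] Matrix K K ℂ) : Prop :=
  ∀ (n : ℕ) (M : Matrix (Fin n × I) (Fin n × I) ℂ), M.PosSemidef →
    (Matrix.of fun p q : Fin n × K =>
      Φ (Matrix.of fun i j => M (p.1, i) (q.1, j)) p.2 q.2).PosSemidef

/-- A quantum channel: a completely positive trace preserving map. -/
structure IsQuantumChannel {I K : Type} [Fintype I] [Fintype K]
    (Φ : Matrix I I ℂ →ₗ[ℂ] Matrix K K ℂ) : Prop where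
  completelyPositive : IsCompletelyPositive Φ
  tracePreserving : ∀ ρ, (Φ ρ).trace = ρ.trace

section Correlations

variable {X Y A B : Type} [Fintype X] [DecidableEq X] [Fintype Y] [DecidableEq Y]
  [Fintype A] [Fintype B]

/-- A quantum no-signalling (QNS) correlation `Γ : M_{XY} → M_{AB}`. -/
structure IsQNS (Γ : Matrix (X × Y) (X × Y) ℂ →ₗ[ℂ] Matrix (A × B) (A × B) ℂ) : Prop where
  channel : IsQuantumChannel Γ
  trFst_eq_zero : ∀ (ρ : Matrix X X ℂ) (σ : Matrix Y Y ℂ), ρ.trace = 0 → trFst (Γ (ρ ⊗ₖ σ)) = 0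
  trSnd_eq_zero : ∀ (ρ : Matrix X X ℂ) (σ : Matrix Y Y ℂ), σ.trace = 0 → trSnd (Γ (ρ ⊗ₖ σ)) = 0

/-- A stochastic operator matrix `(E_{x,x',a,a'})` over `(X, A)` acting on `H`: the block operator
matrix with rows indexed by `(x, a)` and columns indexed by `(x', a')` is positive as an operator
on `⨁_{X × A} H`, and `∑_a E_{x,x',a,a} = δ_{x,x'} 1`. -/
structure IsStochastic {H : Type} [NormedAddCommGroup H] [InnerProductSpace ℂ H]
    (E : X → X → A → A → (H →L[ℂ] H)) : Prop where
  positive : ∀ η : X × A → H,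
    0 ≤ ∑ p : X × A, ∑ q : X × A, inner ℂ (η p) (E p.1 q.1 p.2 q.2 (η q))
  trace_eq_one : ∀ x x', ∑ a, E x x' a a = if x = x' then 1 else 0

/-- The class `Q_qc` of quantum commuting QNS correlations. -/
def IsQuantumCommuting (Γ : Matrix (X × Y) (X × Y) ℂ →ₗ[ℂ] Matrix (A × B) (A × B) ℂ) : Prop :=
  IsQNS Γ ∧
  ∃ (H : Type) (_ : NormedAddCommGroup H) (_ : InnerProductSpace ℂ H) (_ : CompleteSpace H)
    (ξ : H) (E : X → X → A → A → (H →L[ℂ] H)) (F : Y → Y → B → B → (H →L[ℂ] H)),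
    ‖ξ‖ = 1 ∧ IsStochastic E ∧ IsStochastic F ∧
    (∀ x x' a a' y y' b b', Commute (E x x' a a') (F y y' b b')) ∧
    ∀ x x' y y' a a' b b',
      Γ (eps x x' ⊗ₖ eps y y') (a, b) (a', b') = inner ℂ ξ ((E x x' a a' * F y y' b b') ξ)

open scoped TensorProduct in
/-- The class `Q_q` of quantum QNS correlations: tensor products of stochastic operator matrices
acting on finite dimensional Hilbert spaces. -/
def IsQuantum (Γ : Matrix (X × Y) (X × Y) ℂ →ₗ[ℂ] Matrix (A × B) (A × B) ℂ) : Prop :=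
  IsQNS Γ ∧
  ∃ (H : Type) (_ : NormedAddCommGroup H) (_ : InnerProductSpace ℂ H) (_ : FiniteDimensional ℂ H)
    (K : Type) (_ : NormedAddCommGroup K) (_ : InnerProductSpace ℂ K) (_ : FiniteDimensional ℂ K)
    (ξ : H ⊗[ℂ] K) (E : X → X → A → A → (H →L[ℂ] H)) (F : Y → Y → B → B → (K →L[ℂ] K)),
    ‖ξ‖ = 1 ∧ IsStochastic E ∧ IsStochastic F ∧
    ∀ x x' y y' a a' b b',
      Γ (eps x x' ⊗ₖ eps y y') (a, b) (a', b') =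
        inner ℂ ξ (TensorProduct.map (E x x' a a' : H →ₗ[ℂ] H) (F y y' b b' : K →ₗ[ℂ] K) ξ)

/-- The class `Q_loc` of local QNS correlations: as for quantum commuting ones, but with the
entries of `E`, and the entries of `F`, pairwise commuting. -/
def IsLocal (Γ : Matrix (X × Y) (X × Y) ℂ →ₗ[ℂ] Matrix (A × B) (A × B) ℂ) : Prop :=
  IsQNS Γ ∧
  ∃ (H : Type) (_ : NormedAddCommGroup H) (_ : InnerProductSpace ℂ H) (_ : CompleteSpace H)
    (ξ : H) (E : X → X → A → A → (H →L[ℂ] H)) (F : Y → Y → B → B → (H →L[ℂ] H)),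
    ‖ξ‖ = 1 ∧ IsStochastic E ∧ IsStochastic F ∧
    (∀ x x' a a' y y' b b', Commute (E x x' a a') (F y y' b b')) ∧
    (∀ x x' a a' y y' b b', Commute (E x x' a a') (E y y' b b')) ∧
    (∀ x x' a a' y y' b b', Commute (F x x' a a') (F y y' b b')) ∧
    ∀ x x' y y' a a' b b',
      Γ (eps x x' ⊗ₖ eps y y') (a, b) (a', b') = inner ℂ ξ ((E x x' a a' * F y y' b b') ξ)

end Correlations

/-! ### Projection lattices and quantum non-local games -/

/-- The projections (self-adjoint idempotents) of `M_I`. -/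
def Proj (I : Type) [Fintype I] : Type := {P : Matrix I I ℂ // IsStarProjection P}

/-- The usual order of projections: `P ≤ Q` iff `Q P = P`, i.e. iff `ran P ⊆ ran Q`. -/
instance (I : Type) [Fintype I] : PartialOrder (Proj I) where
  le P Q := Q.1 * P.1 = P.1
  le_refl P := P.2.isIdempotentElem
  le_trans P Q R h₁ h₂ := by
    have h₁' : Q.1 * P.1 = P.1 := h₁
    have h₂' : R.1 * Q.1 = Q.1 := h₂
    rw [← h₁', ← Matrix.mul_assoc, h₂']
  le_antisymm P Q h₁ h₂ := by
    have h₁' : Q.1 * P.1 = P.1 := h₁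
    have h₂' : P.1 * Q.1 = Q.1 := h₂
    have e : star (Q.1 * P.1) = P.1 * Q.1 := by
      rw [star_mul, P.2.isSelfAdjoint.star_eq, Q.2.isSelfAdjoint.star_eq]
    apply Subtype.ext
    rw [← h₂', ← e, h₁', P.2.isSelfAdjoint.star_eq]

instance (I : Type) [Fintype I] : Zero (Proj I) := ⟨⟨0, IsStarProjection.zero _⟩⟩

instance (I : Type) [Fintype I] [DecidableEq I] : One (Proj I) := ⟨⟨1, IsStarProjection.one _⟩⟩

/-- A quantum non-local game `φ : P_{XY} → P_{AB}`: a join-preserving map with `φ 0 = 0`.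
(Every family in a projection lattice of a matrix algebra has a least upper bound.) -/
structure QuantumGame (X Y A B : Type) [Fintype X] [Fintype Y] [Fintype A] [Fintype B] where
  toFun : Proj (X × Y) → Proj (A × B)
  map_zero : toFun 0 = 0
  map_join : ∀ (S : Set (Proj (X × Y))) (R : Proj (X × Y)), IsLUB S R → IsLUB (toFun '' S) (toFun R)

/-- `Γ` is a perfect strategy for `φ`: `⟨Γ(P), φ(P)_⊥⟩ = Tr (Γ(P) (1 - φ(P))) = 0` for every
projection `P`. -/
def IsPerfect {X Y A B : Type} [Fintype X] [Fintype Y] [Fintype A] [Fintype B]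
    [DecidableEq A] [DecidableEq B]
    (Γ : Matrix (X × Y) (X × Y) ℂ →ₗ[ℂ] Matrix (A × B) (A × B) ℂ)
    (φ : QuantumGame X Y A B) : Prop :=
  ∀ P : Proj (X × Y), (Γ P.1 * (1 - (φ.toFun P).1)).trace = 0

/-- The matrix `J_X = |X|⁻¹ ∑_{x,x'} ε_{x,x'} ⊗ ε_{x,x'}`. -/
def maxEntMatrix (X : Type) [Fintype X] [DecidableEq X] : Matrix (X × X) (X × X) ℂ :=
  (Fintype.card X : ℂ)⁻¹ • ∑ x : X, ∑ x' : X, eps x x' ⊗ₖ eps x x'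

theorem maxEntMatrix_apply {X : Type} [Fintype X] [DecidableEq X] (p q : X × X) :
    maxEntMatrix X p q =
      (Fintype.card X : ℂ)⁻¹ * ((if p.1 = p.2 then 1 else 0) * (if q.1 = q.2 then 1 else 0)) := by
  obtain ⟨a, b⟩ := p
  obtain ⟨c, d⟩ := q
  simp only [maxEntMatrix, eps, Matrix.smul_apply, Matrix.sum_apply, Matrix.kroneckerMap_apply,
    Matrix.single_apply, smul_eq_mul]
  congr 1
  rw [Finset.sum_eq_single a, Finset.sum_eq_single c]
  · split_ifs <;> simp_all
  · intro x _ hx; simp [hx]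
  · simp
  · intro x _ hx; simp [hx]
  · simp

theorem maxEntMatrix_isStarProjection (X : Type) [Fintype X] [DecidableEq X] :
    IsStarProjection (maxEntMatrix X) := by
  constructor
  · ext p q
    rw [Matrix.mul_apply]
    simp only [maxEntMatrix_apply]
    have h1 : ∑ r : X × X, (if r.1 = r.2 then (1 : ℂ) else 0) = Fintype.card X := by
      rw [Fintype.sum_prod_type]; simp
    have hc : (Fintype.card X : ℂ) ≠ 0 := by
      have : Nonempty X := ⟨p.1⟩
      exact_mod_cast Fintype.card_ne_zero
    calc _ = ∑ r : X × X, (if r.1 = r.2 then (1 : ℂ) else 0) * ((Fintype.card X : ℂ)⁻¹ *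
          (Fintype.card X : ℂ)⁻¹ * ((if p.1 = p.2 then 1 else 0) * (if q.1 = q.2 then 1 else 0))) := by
          refine Finset.sum_congr rfl fun r _ => ?_
          split_ifs <;> simp
      _ = _ := by
          rw [← Finset.sum_mul, h1]
          field_simp
  · ext p q
    simp only [Matrix.star_apply, maxEntMatrix_apply]
    split_ifs <;> simp

/-- The maximally entangled rank one projection `J_X`. -/
def maxEnt (X : Type) [Fintype X] [DecidableEq X] : Proj (X × X) :=
  ⟨maxEntMatrix X, maxEntMatrix_isStarProjection X⟩

/-- A concurrent quantum game: `φ(J_X) = J_A`. -/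
def QuantumGame.IsConcurrent {X A : Type} [Fintype X] [DecidableEq X] [Fintype A] [DecidableEq A]
    (φ : QuantumGame X X A A) : Prop :=
  φ.toFun (maxEnt X) = maxEnt A

/-- The only projections below `J_X` are `0` and `J_X`. -/
theorem le_maxEnt {X : Type} [Fintype X] [DecidableEq X] {P : Proj (X × X)} (h : P ≤ maxEnt X) :
    P = 0 ∨ P = maxEnt X := by
  have h1 : maxEntMatrix X * P.1 = P.1 := h
  have h2 : P.1 * maxEntMatrix X = P.1 := by
    have := congrArg star h1
    rwa [star_mul, P.2.isSelfAdjoint.star_eq,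
      (maxEntMatrix_isStarProjection X).isSelfAdjoint.star_eq] at this
  obtain ⟨c, hc⟩ : ∃ c : ℂ, P.1 = c • maxEntMatrix X := by
    refine ⟨(Fintype.card X : ℂ)⁻¹ * ∑ s : X × X, ∑ r : X × X,
      (if r.1 = r.2 then 1 else 0) * P.1 r s * (if s.1 = s.2 then 1 else 0), ?_⟩
    conv_lhs => rw [← h2, ← h1]
    ext p q
    simp only [Matrix.mul_apply, Matrix.smul_apply, maxEntMatrix_apply, smul_eq_mul,
      Finset.sum_mul, Finset.mul_sum]
    refine Finset.sum_congr rfl fun s _ => Finset.sum_congr rfl fun r _ => ?_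
    ring
  have hP := P.2.isIdempotentElem
  rw [IsIdempotentElem, hc, smul_mul_smul_comm,
    (maxEntMatrix_isStarProjection X).isIdempotentElem] at hP
  by_cases h0 : maxEntMatrix X = 0
  · left; apply Subtype.ext; rw [hc, h0, smul_zero]; rfl
  · have h3 : c * c = c := smul_left_injective ℂ h0 hP
    rcases (IsIdempotentElem.iff_eq_zero_or_one (p := c)).1 h3 with h | h
    · left; apply Subtype.ext; rw [hc, h, zero_smul]; rfl
    · right; apply Subtype.ext; rw [hc, h, one_smul]; rfl

open Classical in
/-- The quantum concurrency game: `0 ↦ 0`, `J_X ↦ J_A`, and `P ↦ 1` for every other projection `P`;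
that is, the concurrent game that imposes no rule besides concurrency. -/
def concurrencyGame (X A : Type) [Fintype X] [DecidableEq X] [Nonempty X]
    [Fintype A] [DecidableEq A] : QuantumGame X X A A where
  toFun P := if P = 0 then 0 else if P = maxEnt X then maxEnt A else 1
  map_zero := by simp
  map_join := by
    intro S R hR
    have zle : ∀ {I : Type} [Fintype I] (P : Proj I), (0 : Proj I) ≤ P :=
      fun P => Matrix.mul_zero P.1
    have leo : ∀ P : Proj (A × A), P ≤ 1 := fun P => Matrix.one_mul P.1
    have le0 : ∀ {P : Proj (X × X)}, P ≤ 0 → P = 0 := fun h => le_antisymm h (zle _)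
    constructor
    · rintro _ ⟨P, hP, rfl⟩
      have hPR := hR.1 hP
      dsimp only
      by_cases h0 : P = 0
      · rw [if_pos h0]; exact zle _
      have hR0 : R ≠ 0 := fun h => h0 (le0 (h ▸ hPR))
      rw [if_neg h0, if_neg hR0]
      by_cases hRJ : R = maxEnt X
      · have hPJ : P = maxEnt X := (le_maxEnt (hRJ ▸ hPR)).resolve_left h0
        rw [if_pos hRJ, if_pos hPJ]
      · rw [if_neg hRJ]; exact leo _
    · intro U hU
      by_cases hR0 : R = 0
      · rw [if_pos hR0]; exact zle _
      rw [if_neg hR0]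
      by_cases hRJ : R = maxEnt X
      · rw [if_pos hRJ]
        have : ∃ P ∈ S, P ≠ 0 := by
          by_contra! hS
          exact hR0 (le0 (hR.2 fun P hP => (hS P hP).le))
        obtain ⟨P, hP, h0⟩ := this
        have hPJ : P = maxEnt X := (le_maxEnt (hRJ ▸ hR.1 hP)).resolve_left h0
        have := hU ⟨P, hP, rfl⟩
        beta_reduce at this
        rwa [if_neg h0, if_pos hPJ] at this
      · rw [if_neg hRJ]
        have : ∃ P ∈ S, P ≠ 0 ∧ P ≠ maxEnt X := by
          by_contra! hS
          have hle : R ≤ maxEnt X := hR.2 fun P hP => by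
            by_cases h0 : P = 0
            · rw [h0]; exact zle _
            · exact (hS P hP h0).le
          exact (le_maxEnt hle).elim hR0 hRJ
        obtain ⟨P, hP, h0, hJ⟩ := this
        have := hU ⟨P, hP, rfl⟩
        beta_reduce at this
        rwa [if_neg h0, if_neg hJ] at this

theorem concurrencyGame_isConcurrent (X A : Type) [Fintype X] [DecidableEq X] [Nonempty X]
    [Fintype A] [DecidableEq A] : (concurrencyGame X A).IsConcurrent := by
  have h : maxEnt X ≠ 0 := by
    intro h
    obtain ⟨x⟩ := ‹Nonempty X›
    have h1 : maxEntMatrix X (x, x) (x, x) = 0 := by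
      have := congrArg (fun P : Proj (X × X) => P.1 (x, x) (x, x)) h
      exact this
    simp [maxEntMatrix_apply] at h1
  simp [QuantumGame.IsConcurrent, concurrencyGame, h]

/-! ### The Brown algebra and its subalgebra `C_X` -/

/-- A unitary `X × X` matrix `(w_{a,x})` with entries in a nonzero unital C*-algebra. (The zero
C*-algebra contributes nothing to the universal norm.) -/
structure UnitaryModel (X : Type) [Fintype X] [DecidableEq X] : Type 1 where
  alg : Type
  [cstar : CStarAlgebra alg]
  [nontriv : Nontrivial alg]
  w : Matrix X X alg
  unitary : w ∈ unitary (Matrix X X alg)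

attribute [instance] UnitaryModel.cstar UnitaryModel.nontriv

section Brown

variable (X : Type) [Fintype X] [DecidableEq X]

/-- The C*-algebra `∏_w alg_w` (`ℓ^∞`-product) over all unitary matrices `w`.
C*-algebras in `Type` suffice: a C*-algebra with finitely many generators is separable. -/
abbrev UniversalProduct : Type 1 := lp (fun i : UnitaryModel X => i.alg) ∞

instance : CStarAlgebra (UniversalProduct X) where

variable {X}

theorem UnitaryModel.norm_entry_le (i : UnitaryModel X) (a x : X) : ‖i.w a x‖ ≤ 1 := by
  let _ := CStarAlgebra.spectralOrder i.alg
  have _ := CStarAlgebra.spectralOrderedRing i.alg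
  have h : ∑ b, star (i.w b x) * i.w b x = 1 := by
    have := congrFun (congrFun (Unitary.mem_iff.1 i.unitary).1 x) x
    simpa [Matrix.mul_apply, Matrix.star_apply] using this
  have h1 : star (i.w a x) * i.w a x ≤ 1 := by
    rw [← h]
    exact Finset.single_le_sum (f := fun b => star (i.w b x) * i.w b x)
      (fun b _ => star_mul_self_nonneg _) (Finset.mem_univ a)
  have h2 : ‖star (i.w a x) * i.w a x‖ ≤ 1 :=
    (CStarAlgebra.norm_le_one_iff_of_nonneg _ (star_mul_self_nonneg _)).2 h1
  rw [CStarRing.norm_star_mul_self] at h2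
  nlinarith [norm_nonneg (i.w a x)]

/-- The family `(w_{a,x})_w`. -/
def universalEntry (a x : X) : UniversalProduct X :=
  ⟨fun i => i.w a x, memℓp_infty ⟨1, by rintro _ ⟨i, rfl⟩; exact i.norm_entry_le a x⟩⟩

variable (X)

/-- The Brown algebra `B_X`: the universal unital C*-algebra generated by the entries `u_{a,x}` of
a unitary `X × X` matrix. It is realised as the C*-algebra generated by the families
`u_{a,x} = (w_{a,x})_w`, with `w` ranging over all unitary matrices. -/
def brownSubalgebra : StarSubalgebra ℂ (UniversalProduct X) :=
  (StarAlgebra.adjoin ℂ {z | ∃ a x : X, z = universalEntry a x}).topologicalClosure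

/-- The Brown algebra `B_X`, as a type. -/
def BrownAlgebra : Type 1 := brownSubalgebra X

instance : IsClosed (brownSubalgebra X : Set (UniversalProduct X)) :=
  StarSubalgebra.isClosed_topologicalClosure _

instance : CStarAlgebra (BrownAlgebra X) :=
  inferInstanceAs (CStarAlgebra (brownSubalgebra X))

variable {X}

/-- The canonical generators `u_{a,x}` of the Brown algebra. -/
def brownGen (a x : X) : BrownAlgebra X :=
  ⟨universalEntry a x, StarSubalgebra.le_topologicalClosure _
    (StarAlgebra.subset_adjoin ℂ _ ⟨a, x, rfl⟩)⟩

/-- Evaluation of an element of the Brown algebra at a unitary matrix. -/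
def brownEval (i : UnitaryModel X) : BrownAlgebra X →⋆ₐ[ℂ] i.alg where
  toFun z := z.1 i
  map_one' := rfl
  map_mul' _ _ := rfl
  map_zero' := rfl
  map_add' _ _ := rfl
  commutes' _ := rfl
  map_star' _ := rfl

theorem brownEval_apply (i : UnitaryModel X) (z : BrownAlgebra X) :
    brownEval i z = z.1 i := rfl

theorem brownEval_brownGen (i : UnitaryModel X) (a x : X) :
    brownEval i (brownGen a x) = i.w a x := rfl

theorem brownGen_unitary : (Matrix.of brownGen : Matrix X X (BrownAlgebra X)) ∈
    unitary (Matrix X X (BrownAlgebra X)) := by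
  have key : ∀ (z z' : BrownAlgebra X),
      (∀ i : UnitaryModel X, z.1 i = z'.1 i) → z = z' :=
    fun z z' h => Subtype.ext (lp.ext (funext h))
  rw [Unitary.mem_iff]
  constructor
  · ext1 x y
    apply key
    intro i
    have := congrFun (congrFun (Unitary.mem_iff.1 i.unitary).1 x) y
    rw [← brownEval_apply, ← brownEval_apply, Matrix.mul_apply, map_sum]
    simp only [Matrix.star_apply, Matrix.of_apply, map_mul, map_star, brownEval_brownGen]
    have h : brownEval i ((1 : Matrix X X (BrownAlgebra X)) x y) = (1 : Matrix X X i.alg) x y := by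
      by_cases hxy : x = y
      · rw [hxy, Matrix.one_apply_eq, Matrix.one_apply_eq, map_one]
      · rw [Matrix.one_apply_ne hxy, Matrix.one_apply_ne hxy, map_zero]
    rw [h]
    exact this
  · ext1 x y
    apply key
    intro i
    have := congrFun (congrFun (Unitary.mem_iff.1 i.unitary).2 x) y
    rw [← brownEval_apply, ← brownEval_apply, Matrix.mul_apply, map_sum]
    simp only [Matrix.star_apply, Matrix.of_apply, map_mul, map_star, brownEval_brownGen]
    have h : brownEval i ((1 : Matrix X X (BrownAlgebra X)) x y) = (1 : Matrix X X i.alg) x y := by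
      by_cases hxy : x = y
      · rw [hxy, Matrix.one_apply_eq, Matrix.one_apply_eq, map_one]
      · rw [Matrix.one_apply_ne hxy, Matrix.one_apply_ne hxy, map_zero]
    rw [h]
    exact this

/-- The universal property of the Brown algebra. -/
theorem brown_universal {D : Type} [CStarAlgebra D] (w : Matrix X X D)
    (hw : w ∈ unitary (Matrix X X D)) :
    ∃! f : BrownAlgebra X →⋆ₐ[ℂ] D, ∀ a x, f (brownGen a x) = w a x := by
  rcases subsingleton_or_nontrivial D with hD | hD
  · refine ⟨
      { toFun := fun _ => 0
        map_one' := Subsingleton.elim _ _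
        map_mul' := fun _ _ => Subsingleton.elim _ _
        map_zero' := rfl
        map_add' := fun _ _ => Subsingleton.elim _ _
        commutes' := fun _ => Subsingleton.elim _ _
        map_star' := fun _ => Subsingleton.elim _ _ }, fun _ _ => Subsingleton.elim _ _,
      fun g _ => StarAlgHom.ext fun _ => Subsingleton.elim _ _⟩
  · refine ⟨brownEval ⟨D, w, hw⟩, fun a x => brownEval_brownGen ⟨D, w, hw⟩ a x, fun g hg => ?_⟩
    have c1 : Continuous g := map_continuous g
    have c2 : Continuous (brownEval (X := X) ⟨D, w, hw⟩) := map_continuous _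
    refine StarAlgHom.ext_topologicalClosure c1 c2 ?_
    refine StarAlgHom.ext_adjoin ?_
    rintro ⟨_, hz⟩ ⟨a, x, rfl⟩
    exact (hg a x).trans (brownEval_brownGen ⟨D, w, hw⟩ a x).symm

/-- The element `u_{a,x}* u_{a',x'}` of the Brown algebra. -/
def brownProd (x x' a a' : X) : BrownAlgebra X := star (brownGen a x) * brownGen a' x'

variable (X)

/-- The C*-subalgebra `C_X` of the Brown algebra generated by the elements `u_{a,x}* u_{a',x'}`. -/
def cSubalgebra : StarSubalgebra ℂ (BrownAlgebra X) :=
  (StarAlgebra.adjoin ℂ {z | ∃ x x' a a' : X, z = brownProd x x' a a'}).topologicalClosure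

/-- The C*-algebra `C_X`, as a type. -/
def CAlg : Type 1 := cSubalgebra X

instance : IsClosed (cSubalgebra X : Set (BrownAlgebra X)) :=
  StarSubalgebra.isClosed_topologicalClosure _

instance : CStarAlgebra (CAlg X) := inferInstanceAs (CStarAlgebra (cSubalgebra X))

variable {X}

/-- The canonical generators `p_{x,x',a,a'} = u_{a,x}* u_{a',x'}` of `C_X`. -/
def pGen (x x' a a' : X) : CAlg X :=
  ⟨brownProd x x' a a', StarSubalgebra.le_topologicalClosure _
    (StarAlgebra.subset_adjoin ℂ _ ⟨x, x', a, a', rfl⟩)⟩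

end Brown

/-! ### Tracial states -/

/-- A tracial state on a unital C*-algebra. -/
structure IsTracialState {𝒜 : Type*} [CStarAlgebra 𝒜] (τ : 𝒜 →ₗ[ℂ] ℂ) : Prop where
  map_one : τ 1 = 1
  nonneg : ∀ z, 0 ≤ τ (star z * z)
  trace : ∀ z w, τ (z * w) = τ (w * z)

/-- `τ` factors through a *-representation on a finite dimensional Hilbert space. (If `τ` is a
tracial state then the functional `σ` is automatically a tracial state on the range of `π`.) -/
def FactorsFiniteDimensional {𝒜 : Type*} [CStarAlgebra 𝒜] (τ : 𝒜 →ₗ[ℂ] ℂ) : Prop :=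
  ∃ (H : Type) (_ : NormedAddCommGroup H) (_ : InnerProductSpace ℂ H) (_ : CompleteSpace H)
    (π : 𝒜 →⋆ₐ[ℂ] (H →L[ℂ] H)), FiniteDimensional ℂ H ∧
    ∃ σ : (H →L[ℂ] H) →ₗ[ℂ] ℂ, ∀ z, τ z = σ (π z)

/-- `τ` factors through an abelian *-representation, i.e. one whose range is commutative. -/
def FactorsAbelian {𝒜 : Type*} [CStarAlgebra 𝒜] (τ : 𝒜 →ₗ[ℂ] ℂ) : Prop :=
  ∃ (H : Type) (_ : NormedAddCommGroup H) (_ : InnerProductSpace ℂ H) (_ : CompleteSpace H)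
    (π : 𝒜 →⋆ₐ[ℂ] (H →L[ℂ] H)), (∀ z w, Commute (π z) (π w)) ∧
    ∃ σ : (H →L[ℂ] H) →ₗ[ℂ] ℂ, ∀ z, τ z = σ (π z)

/-- `Γ(ε_{x,x'} ⊗ ε_{y,y'}) = (τ(p_{x,x',a,a'} p_{y',y,b',b}))_{a,a',b,b'}` for all `x, x', y, y'`. -/
def IsRepresentedBy {X : Type} [Fintype X] [DecidableEq X]
    (Γ : Matrix (X × X) (X × X) ℂ →ₗ[ℂ] Matrix (X × X) (X × X) ℂ) (τ : CAlg X →ₗ[ℂ] ℂ) : Prop :=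
  ∀ x x' y y' : X, Γ (eps x x' ⊗ₖ eps y y') =
    ∑ a, ∑ a', ∑ b, ∑ b', τ (pGen x x' a a' * pGen y' y b' b) • (eps a a' ⊗ₖ eps b b')

end QNS

end

/-! Write q = (x,x',a,a') and q* = (x',x,a',a). Since Γ preserves traces, its condition at J, the
only one with content for the concurrency game, says that ∑_q ⟨E_q F_q ξ, ξ⟩ = |X|². This is the
largest value possible. Indeed E is a compression of T_q = w_{a,x}* w_{a',x'} for a unitary matrix w
on a larger space (`IsStochastic.exists_dilation`), and ∑_q T_q* T_q = |X|² (`sum_pGen_mul_star`),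
so ∑_q ‖E_q ξ‖² ≤ |X|², and likewise for F.

Equality in Cauchy-Schwarz forces F_q ξ = E_q* ξ, and equality in the compression bound forces T_q ξ
= E_q ξ. As E commutes with the algebra generated by F, the second equality propagates to the cyclic
space of F (`dilation_apply_of_saturated`): T_q f ξ = f F_{q*} ξ. Thus on that space C_X acts by
right multiplication on the algebra of F, and the vector state of ξ on C_X is tracial and represents
Γ (`exists_tracialState_of_saturated`). The dilation of a finite dimensional space is finite
dimensional. If F commutes, so does the action of C_X on the closed cyclic space. This gives the
forward halves of the two refinements. Conversely, a representing trace gives ∑_q τ(p_q p_{q*}) =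
|X|², hence perfection.

For the converse refinements, a trace through a finite dimensional representation has a central
density r² with respect to the matrix trace; the vector ∑ r b_i ⊗ b_i, the representation, and its
transpose on the second leg realise Γ. A trace through an abelian representation becomes a vector
state by the GNS construction on the commutative range, where both E and F can be read off from the
same commuting operators. -/

open scoped Matrix Kronecker ComplexOrder ENNReal CStarAlgebra

noncomputable section

namespace QNS

/-! ### Unitary dilation of stochastic operator matrices. -/

section Dilation

variable {ι H : Type} [Fintype ι] [NormedAddCommGroup H] [InnerProductSpace ℂ H]

/-- The operator on `⨁ H` with block matrix `(A p q)`. -/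
def blockOp (A : ι → ι → (H →L[ℂ] H)) :
    PiLp 2 (fun _ : ι => H) →L[ℂ] PiLp 2 (fun _ : ι => H) :=
  (PiLp.continuousLinearEquiv 2 ℂ (fun _ : ι => H)).symm.toContinuousLinearMap ∘L
    ContinuousLinearMap.pi fun p => ∑ q, A p q ∘L PiLp.proj 2 (fun _ : ι => H) q

theorem blockOp_apply (A : ι → ι → (H →L[ℂ] H)) (η : PiLp 2 (fun _ : ι => H)) (p : ι) :
    blockOp A η p = ∑ q, A p q (η q) := by
  simp [blockOp]

theorem exists_eq_star_mul_self_of_nonneg {K : Type*} [NormedAddCommGroup K]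
    [InnerProductSpace ℂ K] [CompleteSpace K] {T : K →L[ℂ] K} (hT : 0 ≤ T) :
    ∃ S : K →L[ℂ] K, T = star S * S :=
  CStarAlgebra.nonneg_iff_eq_star_mul_self.1 hT

/-- A positive block operator matrix is a Gram matrix of operators. -/
theorem exists_gram_of_positive [CompleteSpace H] [DecidableEq ι] (A : ι → ι → (H →L[ℂ] H))
    (hA : ∀ η : ι → H, 0 ≤ ∑ p, ∑ q, inner ℂ (η p) (A p q (η q))) :
    ∃ V : ι → (H →L[ℂ] PiLp 2 (fun _ : ι => H)),
      ∀ p q h h', inner ℂ (V p h) (V q h') = inner ℂ h (A p q h') := by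
  have hpos : 0 ≤ blockOp A := by
    rw [ContinuousLinearMap.nonneg_iff_isPositive, ContinuousLinearMap.isPositive_iff_complex]
    intro η
    have h0 : 0 ≤ inner ℂ η (blockOp A η) := by
      simpa [PiLp.inner_apply, blockOp_apply, inner_sum] using hA η
    rw [← inner_conj_symm] at h0
    have h1 : 0 ≤ inner ℂ (blockOp A η) η := by
      have := star_nonneg_iff.2 h0
      simpa using this
    obtain ⟨h2, h3⟩ := Complex.nonneg_iff.1 h1
    refine ⟨?_, h2⟩
    apply Complex.ext <;> simp [← h3]
  -- V_p is S restricted to the p-th summand, so V_p* V_q is the (p,q) block of S* S.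
  obtain ⟨S, hS⟩ := exists_eq_star_mul_self_of_nonneg hpos
  let e : ι → (H →L[ℂ] PiLp 2 (fun _ : ι => H)) := fun p =>
    (PiLp.continuousLinearEquiv 2 ℂ (fun _ : ι => H)).symm.toContinuousLinearMap ∘L
      ContinuousLinearMap.single ℂ (fun _ : ι => H) p
  have he : ∀ p h q, e p h q = if q = p then h else 0 := by
    intro p h q
    by_cases hq : q = p
    · subst hq; simp [e]
    · simp [e, hq]
  refine ⟨fun p => S ∘L e p, fun p q h h' => ?_⟩
  have h1 : inner ℂ (S (e p h)) (S (e q h')) = inner ℂ (e p h) (blockOp A (e q h')) := by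
    rw [hS, mul_apply_eq_comp, ContinuousLinearMap.star_eq_adjoint,
      ContinuousLinearMap.adjoint_inner_right]
  simp only [ContinuousLinearMap.comp_apply]
  rw [h1, PiLp.inner_apply]
  simp only [he, blockOp_apply]
  rw [Finset.sum_eq_single p, Finset.sum_eq_single q]
  · simp
  · intro r _ hr; simp [hr]
  · simp
  · intro r _ hr; simp [hr]
  · simp

/-- If `v` is a partial isometry with initial projection `e` and `e v = 0`, then
`v + v* + (1 - e - v v*)` is a self-adjoint unitary. -/
theorem dilation_mem_unitary {R : Type*} [Ring R] [StarRing R] {v e : R} (h1 : star v * v = e)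
    (h2 : e * v = 0) (h3 : v * e = v) : v + star v + (1 - e - v * star v) ∈ unitary R := by
  have he : star e = e := by rw [← h1]; simp
  have h2' : star v * e = 0 := by simpa [he] using congrArg star h2
  have h3' : e * star v = star v := by simpa [he] using congrArg star h3
  have h4 : v * v = 0 := by
    calc v * v = v * e * v := by rw [h3]
      _ = 0 := by rw [mul_assoc, h2, mul_zero]
  have h4' : star v * star v = 0 := by simpa using congrArg star h4
  have h5 : e * e = e := by
    calc e * e = star v * (v * e) := by rw [← mul_assoc, h1]
      _ = e := by rw [h3, h1]
  have hs : star (v + star v + (1 - e - v * star v)) = v + star v + (1 - e - v * star v) := by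
    simp [he]; abel
  have h6 : v * (v * star v) = 0 := by rw [← mul_assoc, h4, zero_mul]
  have h7 : star v * (v * star v) = star v := by rw [← mul_assoc, h1, h3']
  have h8 : e * (v * star v) = 0 := by rw [← mul_assoc, h2, zero_mul]
  -- The element exchanges the orthogonal projections e and v v* by means of v and is the identity
  -- on their complement, so its square is 1.
  have hsq : (v + star v + (1 - e - v * star v)) * (v + star v + (1 - e - v * star v)) = 1 := by
    simp only [mul_add, add_mul, mul_sub, sub_mul, mul_one, one_mul, mul_assoc, h1, h2, h3, h2',
      h3', h4, h4', h5, h6, h7, h8, mul_zero]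
    abel
  rw [Unitary.mem_iff, hs]
  exact ⟨hsq, hsq⟩

variable {X : Type} [Fintype X] [DecidableEq X]

/-- Every stochastic operator matrix is a compression of one of the form `(w_{a,x}* w_{a',x'})`
with a unitary matrix `w`. -/
theorem IsStochastic.exists_dilation [CompleteSpace H] {E : X → X → X → X → (H →L[ℂ] H)}
    (hE : IsStochastic E) :
    ∃ (L : Type) (_ : NormedAddCommGroup L) (_ : InnerProductSpace ℂ L) (_ : CompleteSpace L)
      (i : H →ₗᵢ[ℂ] L) (w : Matrix X X (L →L[ℂ] L)), (FiniteDimensional ℂ H → FiniteDimensional ℂ L) ∧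
      w ∈ unitary (Matrix X X (L →L[ℂ] L)) ∧
      ∀ x x' a a' h h', inner ℂ (w a x (i h)) (w a' x' (i h')) = inner ℂ h (E x x' a a' h') := by
  obtain ⟨V, hV⟩ := exists_gram_of_positive (fun p q : X × X => E p.1 q.1 p.2 q.2) hE.positive
  let K := PiLp 2 (fun _ : X × X => H)
  let L := WithLp 2 (H × K)
  let i : H →ₗᵢ[ℂ] L := ⟨(WithLp.linearEquiv 2 ℂ (H × K)).symm.toLinearMap ∘ₗ LinearMap.inl ℂ H K,
    fun h => by simp [L]⟩
  let j : K →ₗᵢ[ℂ] L := ⟨(WithLp.linearEquiv 2 ℂ (H × K)).symm.toLinearMap ∘ₗ LinearMap.inr ℂ H K,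
    fun h => by simp [L]⟩
  let P : L →L[ℂ] H := WithLp.fstL 2 ℂ H K
  have hPi : ∀ h, P (i h) = h := fun h => rfl
  have hPj : ∀ k, P (j k) = 0 := fun k => rfl
  have hP : ∀ h l, inner ℂ (i h) l = inner ℂ h (P l) := fun h l => by
    rw [WithLp.prod_inner_apply]
    change inner ℂ h l.fst + inner ℂ (0 : K) l.snd = inner ℂ h l.fst
    rw [inner_zero_left, add_zero]
  have hij : ∀ h k, inner ℂ (i h) (j k) = 0 := fun h k => by rw [hP, hPj, inner_zero_right]
  -- On L = H ⊕ K the Gram operators are placed so that they send the H part into the K part. The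
  -- trace condition on E makes v* v the diagonal projection onto H, and e v = 0 because K is
  -- orthogonal to H.
  let v : Matrix X X (L →L[ℂ] L) := Matrix.of fun a x =>
    j.toContinuousLinearMap ∘L V (x, a) ∘L P
  let e₀ : L →L[ℂ] L := i.toContinuousLinearMap ∘L P
  let e : Matrix X X (L →L[ℂ] L) := Matrix.scalar X e₀
  have hv : ∀ a x l, v a x l = j (V (x, a) (P l)) := fun _ _ _ => rfl
  have hstar : ∀ x x' a a', star (v a x) * v a' x' = i.toContinuousLinearMap ∘L E x x' a a' ∘L P := by
    intro x x' a a'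
    ext1 l
    refine ext_inner_left ℂ fun m => ?_
    rw [mul_apply_eq_comp, ContinuousLinearMap.star_eq_adjoint,
      ContinuousLinearMap.adjoint_inner_right, hv, hv, j.inner_map_map, hV]
    simp only [ContinuousLinearMap.comp_apply, LinearIsometry.coe_toContinuousLinearMap]
    rw [← inner_conj_symm m, hP, inner_conj_symm]
  have h1 : star v * v = e := by
    ext1 x x'
    rw [Matrix.mul_apply]
    simp only [Matrix.star_apply, hstar]
    have : ∑ a, i.toContinuousLinearMap ∘L E x x' a a ∘L P =
        i.toContinuousLinearMap ∘L (∑ a, E x x' a a) ∘L P := by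
      ext1 l; simp
    rw [this, hE.trace_eq_one]
    by_cases hx : x = x'
    · subst hx; simp [e, e₀]; rfl
    · simp [e, hx]
  have h2 : e * v = 0 := by
    ext1 a x
    simp only [e, Matrix.scalar_apply, Matrix.diagonal_mul, Matrix.zero_apply]
    ext1 l
    simp [e₀, hv, hPj]
  have h3 : v * e = v := by
    ext1 a x
    simp only [e, Matrix.scalar_apply, Matrix.mul_diagonal]
    ext1 l
    simp [e₀, hv, hPi]
  refine ⟨L, inferInstance, inferInstance, inferInstance, i, _, fun _ => ?_,
    dilation_mem_unitary h1 h2 h3, ?_⟩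
  · exact (WithLp.linearEquiv 2 ℂ (H × K)).symm.finiteDimensional
  have hstar0 : ∀ a x h, star (v a x) (i h) = 0 := by
    intro a x h
    refine ext_inner_left ℂ fun m => ?_
    rw [ContinuousLinearMap.star_eq_adjoint, ContinuousLinearMap.adjoint_inner_right, hv,
      ← inner_conj_symm, hij, map_zero, inner_zero_right]
  -- On vectors from H all the correction terms v*, 1 - e and v v* vanish, so the unitary acts there
  -- as v alone.
  have hwi : ∀ a x h, (v + star v + (1 - e - v * star v)) a x (i h) = j (V (x, a) h) := by
    intro a x h
    have hvv : (v * star v) a x (i h) = 0 := by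
      rw [Matrix.mul_apply, _root_.sum_apply]
      exact Finset.sum_eq_zero fun y _ => by
        rw [mul_apply_eq_comp, Matrix.star_apply, hstar0, map_zero]
    have h1e : ((1 : Matrix X X (L →L[ℂ] L)) - e) a x (i h) = 0 := by
      by_cases hax : a = x
      · subst hax; simp [e, e₀, hPi]
      · simp [e, hax]
    have : (v + star v + (1 - e - v * star v)) a x (i h) = v a x (i h) + star (v x a) (i h) +
      (((1 : Matrix X X (L →L[ℂ] L)) - e) a x (i h) - (v * star v) a x (i h)) := rfl
    rw [this, hvv, h1e, hstar0, hv, hPi]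
    simp
  intro x x' a a' h h'
  rw [hwi, hwi, j.inner_map_map, hV]

end Dilation

section

/-! ### Relations in C_X and its dense polynomial subalgebra. -/

section CAlgebra

variable {X : Type} [Fintype X] [DecidableEq X]

/-- The inclusion of `C_X` into the Brown algebra. -/
def cIncl : CAlg X →⋆ₐ[ℂ] BrownAlgebra X where
  toFun z := z.1
  map_one' := rfl
  map_mul' _ _ := rfl
  map_zero' := rfl
  map_add' _ _ := rfl
  commutes' _ := rfl
  map_star' _ := rfl

theorem cIncl_injective : Function.Injective (cIncl (X := X)) := Subtype.val_injective

theorem cIncl_pGen (x x' a a' : X) :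
    cIncl (pGen x x' a a') = star (brownGen a x) * brownGen a' x' := rfl

theorem brownGen_sum_star_mul (x x' : X) :
    ∑ a, star (brownGen a x) * brownGen a x' = if x = x' then (1 : BrownAlgebra X) else 0 := by
  have := congrFun (congrFun (Unitary.mem_iff.1 (brownGen_unitary (X := X))).1 x) x'
  simpa [Matrix.mul_apply, Matrix.one_apply] using this

theorem brownGen_sum_mul_star (a a' : X) :
    ∑ x, brownGen a x * star (brownGen a' x) = if a = a' then (1 : BrownAlgebra X) else 0 := by
  have := congrFun (congrFun (Unitary.mem_iff.1 (brownGen_unitary (X := X))).2 a) a'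
  simpa [Matrix.mul_apply, Matrix.one_apply] using this

theorem star_pGen (x x' a a' : X) : star (pGen x x' a a') = pGen x' x a' a := by
  apply cIncl_injective
  simp [cIncl_pGen, map_star]

theorem sum_pGen_diag (x x' : X) : ∑ a, pGen x x' a a = if x = x' then (1 : CAlg X) else 0 := by
  apply cIncl_injective
  simp only [map_sum, cIncl_pGen, brownGen_sum_star_mul]
  split_ifs <;> simp

/-- Row c of u u* = 1 collapses the two inner factors. Here c is free, which later gives Gram
decompositions inside C_X, to which u itself need not belong. -/
theorem sum_pGen_mul_pGen (x x' a a' c : X) :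
    ∑ y, pGen x y a c * pGen y x' c a' = pGen x x' a a' := by
  apply cIncl_injective
  simp only [map_sum, map_mul, cIncl_pGen]
  calc ∑ y, star (brownGen a x) * brownGen c y * (star (brownGen c y) * brownGen a' x')
      = star (brownGen a x) * (∑ y, brownGen c y * star (brownGen c y)) * brownGen a' x' := by
        rw [Finset.mul_sum, Finset.sum_mul]
        exact Finset.sum_congr rfl fun y _ => by simp only [mul_assoc]
    _ = _ := by rw [brownGen_sum_mul_star]; simp

/-- Summing over x' leaves p_{x,x,a,a}, summing over a leaves 1, and the remaining indices x and a'
contribute |X|². This constant is the maximum that a perfect strategy has to attain. -/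
theorem sum_pGen_mul_star :
    ∑ x, ∑ x', ∑ a, ∑ a', pGen x x' a a' * pGen x' x a' a =
      algebraMap ℂ (CAlg X) ((Fintype.card X : ℂ) ^ 2) := by
  calc ∑ x, ∑ x', ∑ a, ∑ a', pGen x x' a a' * pGen x' x a' a
      = ∑ x : X, ∑ a' : X, ∑ a, ∑ x', pGen x x' a a' * pGen x' x a' a := by
        refine Finset.sum_congr rfl fun x _ => ?_
        rw [Finset.sum_comm, Finset.sum_comm (s := Finset.univ (α := X)) (t := Finset.univ (α := X))
          (f := fun a' a => ∑ x', pGen x x' a a' * pGen x' x a' a)]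
        exact Finset.sum_congr rfl fun a _ => Finset.sum_comm
    _ = _ := by
        simp [sum_pGen_mul_pGen, sum_pGen_diag, sq]

variable (X) in
/-- The dense subalgebra of `C_X` generated by the `p_{x,x',a,a'}`. -/
def cDense : Subalgebra ℂ (CAlg X) := Algebra.adjoin ℂ {z | ∃ x x' a a' : X, z = pGen x x' a a'}

theorem pGen_mem_cDense (x x' a a' : X) : pGen x x' a a' ∈ cDense X :=
  Algebra.subset_adjoin ⟨x, x', a, a', rfl⟩

/-- The generating family is invariant under the involution, so adjoining without stars suffices,
and inductions over `cDense` need no star case. -/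
theorem star_mem_cDense {z : CAlg X} (hz : z ∈ cDense X) : star z ∈ cDense X := by
  induction hz using Algebra.adjoin_induction with
  | mem z hz =>
    obtain ⟨x, x', a, a', rfl⟩ := hz
    rw [star_pGen]; exact pGen_mem_cDense _ _ _ _
  | algebraMap r =>
    rw [← algebraMap_star_comm]; exact Subalgebra.algebraMap_mem _ _
  | add z w _ _ h1 h2 => rw [star_add]; exact add_mem h1 h2
  | mul z w _ _ h1 h2 => rw [star_mul]; exact mul_mem h2 h1

theorem cDense_dense : Dense (cDense X : Set (CAlg X)) := by
  intro z
  have hz : z.1 ∈ (cSubalgebra X : Set (BrownAlgebra X)) := z.2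
  have h1 : (StarAlgebra.adjoin ℂ {z | ∃ x x' a a' : X, z = brownProd x x' a a'} :
      Set (BrownAlgebra X)) ⊆ cIncl '' (cDense X : Set (CAlg X)) := by
    intro y hy
    induction hy using StarAlgebra.adjoin_induction with
    | mem y hy =>
      obtain ⟨x, x', a, a', rfl⟩ := hy
      exact ⟨pGen x x' a a', pGen_mem_cDense _ _ _ _, rfl⟩
    | algebraMap r => exact ⟨algebraMap ℂ (CAlg X) r, Subalgebra.algebraMap_mem (cDense X) r, rfl⟩
    | add y y' _ _ h h' =>
      obtain ⟨w, hw, rfl⟩ := h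
      obtain ⟨w', hw', rfl⟩ := h'
      exact ⟨w + w', add_mem hw hw', rfl⟩
    | mul y y' _ _ h h' =>
      obtain ⟨w, hw, rfl⟩ := h
      obtain ⟨w', hw', rfl⟩ := h'
      exact ⟨w * w', mul_mem hw hw', rfl⟩
    | star y _ h =>
      obtain ⟨w, hw, rfl⟩ := h
      exact ⟨star w, star_mem_cDense hw, rfl⟩
  have h2 : z.1 ∈ closure (cIncl '' (cDense X : Set (CAlg X))) := closure_mono h1 hz
  have h3 : Topology.IsInducing (cIncl (X := X)) := Topology.IsInducing.subtypeVal
  rw [h3.closure_eq_preimage_closure_image]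
  exact h2

/-- The *-homomorphism of the Brown algebra with `u_{a,x} ↦ w_{a,x}`, restricted to `C_X`. -/
theorem exists_starAlgHom_of_unitary {D : Type} [CStarAlgebra D] (w : Matrix X X D)
    (hw : w ∈ unitary (Matrix X X D)) :
    ∃ π : CAlg X →⋆ₐ[ℂ] D, ∀ x x' a a', π (pGen x x' a a') = star (w a x) * w a' x' := by
  obtain ⟨f, hf, -⟩ := brown_universal w hw
  exact ⟨f.comp cIncl, fun x x' a a' => by
    rw [StarAlgHom.comp_apply, cIncl_pGen, map_mul, map_star, hf, hf]⟩

/-- Positivity at 1 + z and at 1 + iz makes the imaginary parts of τ(z) + τ(z*) and of i(τ(z) -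
τ(z*)) vanish. -/
theorem IsTracialState.map_star {𝒜 : Type*} [CStarAlgebra 𝒜] {τ : 𝒜 →ₗ[ℂ] ℂ}
    (hτ : IsTracialState τ) (z : 𝒜) : τ (star z) = star (τ z) := by
  have h1 := hτ.nonneg (1 + z)
  have h2 := hτ.nonneg (1 + Complex.I • z)
  have h3 := hτ.nonneg z
  simp only [star_add, star_one, star_smul, mul_add, add_mul, mul_one, one_mul, map_add, map_smul,
    hτ.map_one, smul_mul_assoc, mul_smul_comm, smul_eq_mul] at h1 h2
  rw [Complex.nonneg_iff] at h1 h2 h3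
  apply Complex.ext
  · have := h2.2; simp at this ⊢; have := h3.2; simp at *; linarith
  · have := h1.2; have := h3.2; simp at *; linarith

end CAlgebra

end

section

/-! ### Equality cases for compressions and for Cauchy-Schwarz. -/

section Saturation

variable {Q H L : Type} [Fintype Q] [NormedAddCommGroup H] [InnerProductSpace ℂ H]
  [NormedAddCommGroup L] [InnerProductSpace ℂ L] {s : Q → Q} {c : ℝ} {i : H →ₗᵢ[ℂ] L}
  {T : Q → (L →L[ℂ] L)} {E F : Q → (H →L[ℂ] H)}

theorem sum_norm_sq_of_sum_mul (hT : ∀ q l m, inner ℂ (T (s q) l) m = inner ℂ l (T q m))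
    (hs : Function.Involutive s) (hc : ∑ q, T (s q) * T q = algebraMap ℂ (L →L[ℂ] L) c) (l : L) :
    ∑ q, ‖T q l‖ ^ 2 = c * ‖l‖ ^ 2 := by
  have h : ((∑ q, ‖T q l‖ ^ 2 : ℝ) : ℂ) = ((c * ‖l‖ ^ 2 : ℝ) : ℂ) := by
    push_cast
    calc ∑ q, (‖T q l‖ : ℂ) ^ 2 = inner ℂ l ((∑ q, T (s q) * T q) l) := by
          rw [_root_.sum_apply, inner_sum]
          refine Finset.sum_congr rfl fun q _ => ?_
          rw [mul_apply_eq_comp, ← hT (s q), hs, inner_self_eq_norm_sq_to_K]; rfl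
      _ = _ := by
          rw [hc, ContinuousLinearMap.algebraMap_apply, inner_smul_right,
            inner_self_eq_norm_sq_to_K]; rfl
  exact_mod_cast h

omit [Fintype Q] in
-- Pythagoras: i E_q h is the orthogonal projection of T_q i h onto the range of i.
theorem norm_sub_sq_of_compression (hE : ∀ q h h', inner ℂ (i h) (T q (i h')) = inner ℂ h (E q h'))
    (q : Q) (h : H) : ‖T q (i h) - i (E q h)‖ ^ 2 = ‖T q (i h)‖ ^ 2 - ‖E q h‖ ^ 2 := by
  rw [@norm_sub_sq ℂ, i.norm_map, ← inner_conj_symm, hE, inner_self_eq_norm_sq_to_K]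
  simp [← Complex.ofReal_pow]
  ring

theorem sum_norm_sq_le_of_compression
    (hE : ∀ q h h', inner ℂ (i h) (T q (i h')) = inner ℂ h (E q h'))
    (hT : ∀ q l m, inner ℂ (T (s q) l) m = inner ℂ l (T q m))
    (hs : Function.Involutive s) (hc : ∑ q, T (s q) * T q = algebraMap ℂ (L →L[ℂ] L) c) (h : H) :
    ∑ q, ‖E q h‖ ^ 2 ≤ c * ‖h‖ ^ 2 := by
  rw [← i.norm_map h, ← sum_norm_sq_of_sum_mul hT hs hc]
  refine Finset.sum_le_sum fun q _ => ?_
  have := norm_sub_sq_of_compression hE q h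
  nlinarith [sq_nonneg ‖T q (i h) - i (E q h)‖]

theorem apply_eq_of_sum_norm_sq
    (hE : ∀ q h h', inner ℂ (i h) (T q (i h')) = inner ℂ h (E q h'))
    (hT : ∀ q l m, inner ℂ (T (s q) l) m = inner ℂ l (T q m))
    (hs : Function.Involutive s) (hc : ∑ q, T (s q) * T q = algebraMap ℂ (L →L[ℂ] L) c) {h : H}
    (hh : ∑ q, ‖E q h‖ ^ 2 = c * ‖h‖ ^ 2) (q : Q) : T q (i h) = i (E q h) := by
  have h1 : ∑ q, ‖T q (i h) - i (E q h)‖ ^ 2 = 0 := by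
    simp only [norm_sub_sq_of_compression hE, Finset.sum_sub_distrib]
    rw [sum_norm_sq_of_sum_mul hT hs hc, hh, i.norm_map, sub_self]
  rw [Finset.sum_eq_zero_iff_of_nonneg fun q _ => sq_nonneg _] at h1
  have := h1 q (Finset.mem_univ q)
  rwa [sq_eq_zero_iff, norm_eq_zero, sub_eq_zero] at this

/-- The equality case of the Cauchy-Schwarz inequality. -/
theorem apply_eq_of_sum_inner {ξ : H}
    (hs : Function.Involutive s)
    (hEs : ∀ q h h', inner ℂ (E (s q) h) h' = inner ℂ h (E q h'))
    (hEc : ∑ q, ‖E q ξ‖ ^ 2 ≤ c) (hFc : ∑ q, ‖F q ξ‖ ^ 2 ≤ c)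
    (hEF : ∑ q, inner ℂ ξ ((E q * F q) ξ) = c) (q : Q) : F q ξ = E (s q) ξ := by
  -- Since E_{s q} = E_q*, expanding the square gives at most c - 2c + c.
  have h1 : ∑ q, ‖F q ξ - E (s q) ξ‖ ^ 2 ≤ 0 := by
    have h2 : ∀ q, ‖F q ξ - E (s q) ξ‖ ^ 2 =
        ‖F q ξ‖ ^ 2 - 2 * (inner ℂ ξ ((E q * F q) ξ)).re + ‖E (s q) ξ‖ ^ 2 := fun q => by
      rw [@norm_sub_sq ℂ, inner_re_symm, hEs]
      rfl
    have h3 : ∑ q, ‖E (s q) ξ‖ ^ 2 = ∑ q, ‖E q ξ‖ ^ 2 :=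
      Equiv.sum_comp hs.toPerm fun q => ‖E q ξ‖ ^ 2
    have h4 := congrArg Complex.re hEF
    rw [Complex.re_sum, Complex.ofReal_re] at h4
    simp only [h2, Finset.sum_add_distrib, Finset.sum_sub_distrib, h3, ← Finset.mul_sum, h4]
    linarith
  have h5 := le_antisymm h1 (Finset.sum_nonneg fun q _ => sq_nonneg _)
  rw [Finset.sum_eq_zero_iff_of_nonneg fun q _ => sq_nonneg _] at h5
  have := h5 q (Finset.mem_univ q)
  rwa [sq_eq_zero_iff, norm_eq_zero, sub_eq_zero] at this

/-- If `∑ ⟨E_q F_q ξ, ξ⟩` attains its largest possible value then the dilation `T_q` agrees with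
`E_q` on the cyclic subspace generated by `ξ` under the operators `F_q`. -/
theorem dilation_apply_of_saturated {ξ : H} (hξ : ‖ξ‖ = 1)
    (hE : ∀ q h h', inner ℂ (i h) (T q (i h')) = inner ℂ h (E q h'))
    (hT : ∀ q l m, inner ℂ (T (s q) l) m = inner ℂ l (T q m))
    (hs : Function.Involutive s) (hc : ∑ q, T (s q) * T q = algebraMap ℂ (L →L[ℂ] L) c)
    (hcomm : ∀ q q', Commute (E q) (F q'))
    (hFc : ∑ q, ‖F q ξ‖ ^ 2 ≤ c) (hEF : ∑ q, inner ℂ ξ ((E q * F q) ξ) = c) :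
    (∀ q, F q ξ = E (s q) ξ) ∧
    ∀ q, ∀ f ∈ Algebra.adjoin ℂ (Set.range F), T q (i (f ξ)) = i (f (F (s q) ξ)) := by
  have hEs : ∀ q h h', inner ℂ (E (s q) h) h' = inner ℂ h (E q h') := fun q h h' => by
    rw [← hE, ← hT, ← inner_conj_symm, ← hE, inner_conj_symm]
  have hEc := sum_norm_sq_le_of_compression hE hT hs hc ξ
  rw [hξ, one_pow, mul_one] at hEc
  have hFE := apply_eq_of_sum_inner hs hEs hEc hFc hEF
  refine ⟨hFE, ?_⟩
  have hEeq : ∑ q, ‖E q ξ‖ ^ 2 = c := by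
    have : ((∑ q, ‖E q ξ‖ ^ 2 : ℝ) : ℂ) = c := by
      rw [← hEF]
      push_cast
      rw [← Equiv.sum_comp hs.toPerm]
      refine Finset.sum_congr rfl fun q _ => ?_
      change _ = inner ℂ ξ (E q (F q ξ))
      rw [hFE, ← hEs, inner_self_eq_norm_sq_to_K]
      rfl
    exact_mod_cast this
  have hTξ : ∀ q, T q (i ξ) = i (E q ξ) :=
    apply_eq_of_sum_norm_sq hE hT hs hc (by rw [hEeq, hξ, one_pow, mul_one])
  -- T_q agrees with E_q at ξ, so compressing ∑ T_q* T_q = c shows that ξ is an eigenvector of ∑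
  -- E_q* E_q.
  have hD : ∑ q, E (s q) (E q ξ) = (c : ℂ) • ξ := by
    refine ext_inner_left ℂ fun h => ?_
    calc inner ℂ h (∑ q, E (s q) (E q ξ)) = inner ℂ (i h) ((∑ q, T (s q) * T q) (i ξ)) := by
          rw [_root_.sum_apply, inner_sum, inner_sum]
          refine Finset.sum_congr rfl fun q _ => ?_
          rw [mul_apply_eq_comp, hTξ, hE]
      _ = _ := by
          rw [hc, ContinuousLinearMap.algebraMap_apply, inner_smul_right, inner_smul_right,
            i.inner_map_map]
  intro q f hf
  have hfE : ∀ q, Commute (E q) f := by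
    intro q
    induction hf using Algebra.adjoin_induction with
    | mem f hf => obtain ⟨q', rfl⟩ := hf; exact hcomm q q'
    | algebraMap r => exact Algebra.commute_algebraMap_right r _
    | add f g _ _ h1 h2 => exact h1.add_right h2
    | mul f g _ _ h1 h2 => exact h1.mul_right h2
  have hfE' : ∀ q h, E q (f h) = f (E q h) := fun q h => congrArg (fun A => A h) (hfE q).eq
  -- ∑ E_q* E_q commutes with f, so f ξ satisfies the same eigenvalue equation and the compression
  -- bound is attained at f ξ as well.
  have h1 : ∑ q, ‖E q (f ξ)‖ ^ 2 = c * ‖f ξ‖ ^ 2 := by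
    have : ((∑ q, ‖E q (f ξ)‖ ^ 2 : ℝ) : ℂ) = ((c * ‖f ξ‖ ^ 2 : ℝ) : ℂ) := by
      push_cast
      calc ∑ q, (‖E q (f ξ)‖ : ℂ) ^ 2 = inner ℂ (f ξ) (f (∑ q, E (s q) (E q ξ))) := by
            rw [map_sum, inner_sum]
            refine Finset.sum_congr rfl fun q _ => ?_
            rw [← hfE', ← hfE', ← hEs (s q), hs, inner_self_eq_norm_sq_to_K]
            rfl
        _ = _ := by rw [hD, map_smul, inner_smul_right, inner_self_eq_norm_sq_to_K]; rfl
    exact_mod_cast this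
  rw [apply_eq_of_sum_norm_sq hE hT hs hc h1, hfE', hFE, hs]

end Saturation

/-! ### Dilations as representations of C_X, indexed by quadruples. -/

section Index

variable {X : Type} [Fintype X] [DecidableEq X]

/-- The involution `(x, x', a, a') ↦ (x', x, a', a)`. -/
def flip4 (q : X × X × X × X) : X × X × X × X := (q.2.1, q.1, q.2.2.2, q.2.2.1)

omit [Fintype X] [DecidableEq X] in
theorem flip4_involutive : Function.Involutive (flip4 (X := X)) := fun _ => rfl

/-- `p_{x,x',a,a'}` with the indices collected in a quadruple. -/
def pGen4 (q : X × X × X × X) : CAlg X := pGen q.1 q.2.1 q.2.2.1 q.2.2.2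

theorem star_pGen4 (q : X × X × X × X) : star (pGen4 q) = pGen4 (flip4 q) := star_pGen _ _ _ _

theorem sum_pGen4 : ∑ q : X × X × X × X, pGen4 (flip4 q) * pGen4 q =
    algebraMap ℂ (CAlg X) (((Fintype.card X : ℝ) ^ 2 : ℝ) : ℂ) := by
  rw [← Equiv.sum_comp flip4_involutive.toPerm]
  simp only [Function.Involutive.coe_toPerm, flip4_involutive _]
  simp only [Fintype.sum_prod_type, pGen4, flip4]
  rw [sum_pGen_mul_star]
  simp

/-- The data of a dilation of a stochastic operator matrix to a representation of `C_X`. -/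
theorem IsStochastic.exists_rep {H : Type} [NormedAddCommGroup H] [InnerProductSpace ℂ H]
    [CompleteSpace H] {E : X → X → X → X → (H →L[ℂ] H)} (hE : IsStochastic E) :
    ∃ (L : Type) (_ : NormedAddCommGroup L) (_ : InnerProductSpace ℂ L) (_ : CompleteSpace L)
      (i : H →ₗᵢ[ℂ] L) (π : CAlg X →⋆ₐ[ℂ] (L →L[ℂ] L)),
      (FiniteDimensional ℂ H → FiniteDimensional ℂ L) ∧
      (∀ q h h', inner ℂ (i h) (π (pGen4 q) (i h')) =
        inner ℂ h (E q.1 q.2.1 q.2.2.1 q.2.2.2 h')) ∧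
      (∀ q l m, inner ℂ (π (pGen4 (flip4 q)) l) m = inner ℂ l (π (pGen4 q) m)) ∧
      ∑ q, π (pGen4 (flip4 q)) * π (pGen4 q) =
        algebraMap ℂ (L →L[ℂ] L) (((Fintype.card X : ℝ) ^ 2 : ℝ) : ℂ) := by
  obtain ⟨L, _, _, _, i, w, hfd, hw, hwE⟩ := hE.exists_dilation
  obtain ⟨π, hπ⟩ := exists_starAlgHom_of_unitary w hw
  refine ⟨L, inferInstance, inferInstance, inferInstance, i, π, hfd, fun q h h' => ?_,
    fun q l m => ?_, ?_⟩
  · rw [pGen4, hπ, mul_apply_eq_comp, ContinuousLinearMap.star_eq_adjoint,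
      ContinuousLinearMap.adjoint_inner_right, hwE]
  · rw [← star_pGen4, map_star, ContinuousLinearMap.star_eq_adjoint,
      ContinuousLinearMap.adjoint_inner_left]
  · simp only [← map_mul]
    rw [← map_sum, sum_pGen4, AlgHomClass.commutes]

end Index

end

section

/-! ### Vector functionals and restriction to invariant subspaces. -/

section VectorFunctional

variable {H : Type} [NormedAddCommGroup H] [InnerProductSpace ℂ H]

/-- The functional `T ↦ ⟨T ξ, ξ⟩`. -/
def vectorFunctional (ξ : H) : (H →L[ℂ] H) →ₗ[ℂ] ℂ where
  toFun T := inner ℂ ξ (T ξ)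
  map_add' S T := by simp
  map_smul' c T := by simp

theorem vectorFunctional_apply (ξ : H) (T : H →L[ℂ] H) :
    vectorFunctional ξ T = inner ℂ ξ (T ξ) := rfl

theorem zero_le_inner_self (v : H) : (0 : ℂ) ≤ inner ℂ v v := by
  rw [inner_self_eq_norm_sq_to_K]
  change (0 : ℂ) ≤ ((‖v‖ : ℝ) : ℂ) ^ 2
  exact_mod_cast sq_nonneg ‖v‖

theorem eq_of_mem_topologicalClosure {A B : H →L[ℂ] H} {M : Submodule ℂ H}
    (h : ∀ m ∈ M, A m = B m) : ∀ m ∈ M.topologicalClosure, A m = B m :=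
  fun _ hm => Set.EqOn.closure (s := (M : Set H)) h A.continuous B.continuous hm

/-- The restriction of a representation to a closed invariant subspace. -/
theorem exists_restrict_rep [CompleteSpace H] {A : Type*} [Ring A] [StarRing A] [Algebra ℂ A]
    (π : A →⋆ₐ[ℂ] (H →L[ℂ] H)) (M : Submodule ℂ H) [CompleteSpace M]
    (hM : ∀ z, ∀ m ∈ M, π z m ∈ M) :
    ∃ π' : A →⋆ₐ[ℂ] (M →L[ℂ] M), ∀ z (m : M), (π' z m : H) = π z m := by
  refine ⟨{ toFun z := ((π z).comp M.subtypeL).codRestrict M fun m => hM z m m.2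
            map_one' := by ext; simp
            map_mul' z w := by
              ext m
              change π (z * w) (m : H) = π z (π w m)
              rw [map_mul]; rfl
            map_zero' := by ext; simp
            map_add' z w := by
              ext m
              change π (z + w) (m : H) = π z m + π w m
              rw [map_add]; rfl
            commutes' _ := by
              ext m
              change (π (algebraMap ℂ A _)) (m : H) = _
              rw [AlgHomClass.commutes]; rfl
            map_star' z := ?_ }, fun z m => rfl⟩
  rw [ContinuousLinearMap.star_eq_adjoint, ContinuousLinearMap.eq_adjoint_iff]
  intro x y
  change inner ℂ (π (star z) x) (y : H) = inner ℂ (x : H) (π z y)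
  rw [map_star, ContinuousLinearMap.star_eq_adjoint, ContinuousLinearMap.adjoint_inner_left]

end VectorFunctional

/-! ### The tracial state of a saturated commuting pair. -/

variable {X : Type} [Fintype X] [DecidableEq X]

omit [Fintype X] in
theorem eps_kronecker_apply (x x' y y' a a' b b' : X) :
    (eps x x' ⊗ₖ eps y y') (a, b) (a', b') =
      if x = a ∧ x' = a' ∧ y = b ∧ y' = b' then 1 else 0 := by
  simp only [eps, Matrix.kroneckerMap_apply, Matrix.single_apply]
  split_ifs <;> simp_all

theorem isRepresentedBy_iff (Γ : Matrix (X × X) (X × X) ℂ →ₗ[ℂ] Matrix (X × X) (X × X) ℂ)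
    (τ : CAlg X →ₗ[ℂ] ℂ) : IsRepresentedBy Γ τ ↔ ∀ x x' y y' a a' b b',
      Γ (eps x x' ⊗ₖ eps y y') (a, b) (a', b') = τ (pGen x x' a a' * pGen y' y b' b) := by
  have key : ∀ (t : X → X → X → X → ℂ) a a' b b',
      (∑ c, ∑ c', ∑ d, ∑ d', t c c' d d' • (eps c c' ⊗ₖ eps d d')) (a, b) (a', b') =
        t a a' b b' := by
    intro t a a' b b'
    simp only [Matrix.sum_apply, Matrix.smul_apply, eps_kronecker_apply, smul_eq_mul]
    rw [Finset.sum_eq_single a, Finset.sum_eq_single a', Finset.sum_eq_single b,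
      Finset.sum_eq_single b']
    all_goals simp +contextual
  constructor
  · intro h x x' y y' a a' b b'
    rw [h, key fun c c' d d' => τ (pGen x x' c c' * pGen y' y d' d)]
  · intro h x x' y y'
    ext ⟨a, b⟩ ⟨a', b'⟩
    rw [h, key fun c c' d d' => τ (pGen x x' c c' * pGen y' y d' d)]

/-- The elements w with τ(zw) = τ(wz) for all z in the dense subalgebra are stable under products,
by moving one factor around at a time, so generators suffice; continuity does the rest. -/
theorem isTracialState_of_cDense {τ : CAlg X →ₗ[ℂ] ℂ} (hcont : Continuous τ) (h1 : τ 1 = 1)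
    (hpos : ∀ z, 0 ≤ τ (star z * z)) (htr : ∀ q, ∀ z ∈ cDense X, τ (z * pGen4 q) = τ (pGen4 q * z)) :
    IsTracialState τ := by
  have h2 : ∀ w ∈ cDense X, ∀ z ∈ cDense X, τ (z * w) = τ (w * z) := by
    intro w hw
    induction hw using Algebra.adjoin_induction with
    | mem w hw => obtain ⟨x, x', a, a', rfl⟩ := hw; exact htr (x, x', a, a')
    | algebraMap r => intro z _; rw [Algebra.commutes]
    | add u v _ _ h h' => intro z hz; rw [mul_add, add_mul, map_add, map_add, h z hz, h' z hz]
    | mul u v hu hv h h' =>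
      intro z hz
      rw [← mul_assoc, h' _ (mul_mem hz hu), ← mul_assoc, h _ (mul_mem hv hz), mul_assoc]
  refine ⟨h1, hpos, fun z w => ?_⟩
  have h3 : ∀ w ∈ cDense X, ∀ z, τ (z * w) = τ (w * z) := fun w hw z => by
    refine cDense_dense.induction (P := fun z => τ (z * w) = τ (w * z)) (h2 w hw) ?_ z
    exact isClosed_eq (hcont.comp (continuous_mul_const w)) (hcont.comp (continuous_const_mul w))
  refine cDense_dense.induction (P := fun w => τ (z * w) = τ (w * z)) (fun w hw => h3 w hw z) ?_ w
  exact isClosed_eq (hcont.comp (continuous_const_mul z)) (hcont.comp (continuous_mul_const z))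

theorem commute_of_cDense {D : Type} [CStarAlgebra D] (π : CAlg X →⋆ₐ[ℂ] D)
    (h : ∀ z ∈ cDense X, ∀ w ∈ cDense X, π z * π w = π w * π z) (z w : CAlg X) :
    Commute (π z) (π w) := by
  have hc : Continuous π := map_continuous π
  have h3 : ∀ w ∈ cDense X, ∀ z, π z * π w = π w * π z := fun w hw z => by
    refine cDense_dense.induction (P := fun z => π z * π w = π w * π z)
      (fun z hz => h z hz w hw) ?_ z
    exact isClosed_eq (hc.mul continuous_const) (continuous_const.mul hc)
  refine cDense_dense.induction (P := fun w => π z * π w = π w * π z)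
      (fun w hw => h3 w hw z) ?_ w
  exact isClosed_eq (continuous_const.mul hc) (hc.mul continuous_const)

/-- A saturated pair of commuting stochastic operator matrices gives a tracial state of `C_X`. -/
theorem exists_tracialState_of_saturated {H : Type} [NormedAddCommGroup H] [InnerProductSpace ℂ H]
    [CompleteSpace H] {ξ : H} (hξ : ‖ξ‖ = 1) {E F : X → X → X → X → (H →L[ℂ] H)}
    (hE : IsStochastic E) (hF : IsStochastic F)
    (hEF : ∀ x x' a a' y y' b b', Commute (E x x' a a') (F y y' b b'))
    (hsat : ∑ x, ∑ x', ∑ a, ∑ a', inner ℂ ξ ((E x x' a a' * F x x' a a') ξ) =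
      (Fintype.card X : ℂ) ^ 2) :
    ∃ τ : CAlg X →ₗ[ℂ] ℂ, IsTracialState τ ∧
      (∀ x x' a a' y y' b b', τ (pGen x x' a a' * pGen y' y b' b) =
        inner ℂ ξ ((E x x' a a' * F y y' b b') ξ)) ∧
      (FiniteDimensional ℂ H → FactorsFiniteDimensional τ) ∧
      ((∀ x x' a a' y y' b b', Commute (F x x' a a') (F y y' b b')) → FactorsAbelian τ) := by
  obtain ⟨L, _, _, _, i, π, hfd, hπE, hπs, hπc⟩ := hE.exists_rep
  set E4 : X × X × X × X → (H →L[ℂ] H) := fun q => E q.1 q.2.1 q.2.2.1 q.2.2.2 with hE4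
  set F4 : X × X × X × X → (H →L[ℂ] H) := fun q => F q.1 q.2.1 q.2.2.1 q.2.2.2 with hF4
  have hFadj : (∀ q h h', inner ℂ (F4 (flip4 q) h) h' = inner ℂ h (F4 q h')) ∧
      ∑ q, ‖F4 q ξ‖ ^ 2 ≤ (Fintype.card X : ℝ) ^ 2 := by
    -- The dilation of F serves only to provide F_{q*} = F_q* and the norm bound; the trace lives on
    -- the dilation of E.
    obtain ⟨L', _, _, _, i', π', -, hπE', hπs', hπc'⟩ := hF.exists_rep
    constructor
    · intro q h h'
      simp only [hF4]
      rw [← hπE', ← hπs', ← inner_conj_symm, ← hπE', inner_conj_symm]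
    · have := sum_norm_sq_le_of_compression (E := F4) hπE' hπs' flip4_involutive hπc' ξ
      rwa [hξ, one_pow, mul_one] at this
  obtain ⟨hFa, hFc⟩ := hFadj
  have hcomm : ∀ q q', Commute (E4 q) (F4 q') := fun q q' => hEF _ _ _ _ _ _ _ _
  obtain ⟨hFE, hT⟩ := dilation_apply_of_saturated (E := E4) (F := F4) hξ hπE hπs
    flip4_involutive hπc hcomm hFc (by
      simp only [Fintype.sum_prod_type, hE4, hF4]
      rw [hsat]; simp)
  set 𝒜 := Algebra.adjoin ℂ (Set.range F4) with h𝒜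
  have hF𝒜 : ∀ q, F4 q ∈ 𝒜 := fun q => Algebra.subset_adjoin ⟨q, rfl⟩
  have hfE : ∀ q, ∀ f ∈ 𝒜, ∀ h, E4 q (f h) = f (E4 q h) := by
    intro q f hf
    have : Commute (E4 q) f := by
      induction hf using Algebra.adjoin_induction with
      | mem f hf => obtain ⟨q', rfl⟩ := hf; exact hcomm q q'
      | algebraMap r => exact Algebra.commute_algebraMap_right r _
      | add f g _ _ h1 h2 => exact h1.add_right h2
      | mul f g _ _ h1 h2 => exact h1.mul_right h2
    exact fun h => congrArg (fun A => A h) this.eq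
  -- On the cyclic space z acts as right multiplication by g, so a product of elements z corresponds
  -- to the reversed product of the g. One g has to serve all f for the product case to go through.
  have hgen : ∀ z ∈ cDense X, ∃ g ∈ 𝒜, ∀ f ∈ 𝒜, π z (i (f ξ)) = i (f (g ξ)) := by
    intro z hz
    induction hz using Algebra.adjoin_induction with
    | mem z hz =>
      obtain ⟨x, x', a, a', rfl⟩ := hz
      exact ⟨F4 (flip4 (x, x', a, a')), hF𝒜 _, hT (x, x', a, a')⟩
    | algebraMap r =>
      refine ⟨algebraMap ℂ _ r, Subalgebra.algebraMap_mem _ _, fun f _ => ?_⟩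
      rw [AlgHomClass.commutes]
      simp [ContinuousLinearMap.algebraMap_apply]
    | add z w _ _ hz hw =>
      obtain ⟨g, hg, hg'⟩ := hz
      obtain ⟨k, hk, hk'⟩ := hw
      exact ⟨g + k, add_mem hg hk, fun f hf => by simp [hg' f hf, hk' f hf]⟩
    | mul z w _ _ hz hw =>
      obtain ⟨g, hg, hg'⟩ := hz
      obtain ⟨k, hk, hk'⟩ := hw
      refine ⟨k * g, mul_mem hk hg, fun f hf => ?_⟩
      have := hg' (f * k) (mul_mem hf hk)
      rw [map_mul, mul_apply_eq_comp, hk' f hf]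
      exact this
  let τ : CAlg X →ₗ[ℂ] ℂ := vectorFunctional (i ξ) ∘ₗ π.toAlgHom.toLinearMap
  have hτ : ∀ z, τ z = inner ℂ (i ξ) (π z (i ξ)) := fun z => rfl
  have hone : ∀ q, π (pGen4 q) (i ξ) = i (F4 (flip4 q) ξ) := fun q => hT q 1 (one_mem _)
  refine ⟨τ, isTracialState_of_cDense ?_ ?_ ?_ ?_, ?_, fun hH => ?_, fun hFF => ?_⟩
  · have : Continuous π := map_continuous π
    simp only [funext hτ]
    exact continuous_const.inner (this.clm_apply continuous_const)
  · rw [hτ, map_one, one_apply_eq_self, inner_self_eq_norm_sq_to_K, i.norm_map, hξ]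
    simp
  · intro z
    rw [hτ, map_mul, mul_apply_eq_comp, map_star, ContinuousLinearMap.star_eq_adjoint,
      ContinuousLinearMap.adjoint_inner_right]
    exact zero_le_inner_self _
  -- The two sides are ⟨F_{q*} g ξ, ξ⟩ and ⟨g F_{q*} ξ, ξ⟩. Moving F_{q*} across, replacing F_q ξ by
  -- E_{q*} ξ, moving back and commuting E_q past g turns the first into the second.
  · intro q z hz
    obtain ⟨g, hg, hg'⟩ := hgen z hz
    have h1 : π z (i ξ) = i (g ξ) := hg' 1 (one_mem _)
    rw [hτ, hτ, map_mul, map_mul, mul_apply_eq_comp, mul_apply_eq_comp, hone, h1,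
      hg' _ (hF𝒜 _), hT q g hg, i.inner_map_map, i.inner_map_map, ← hFa, flip4_involutive, hFE]
    have hEs : ∀ h h', inner ℂ (E4 (flip4 q) h) h' = inner ℂ h (E4 q h') := fun h h' => by
      simp only [hE4]
      rw [← hπE, ← hπs, ← inner_conj_symm, ← hπE, inner_conj_symm]
    rw [hEs, hfE _ _ hg, hFE, flip4_involutive]
  -- The second generator is p at the flipped index because p_{q*} acts on ξ as F_q.
  · intro x x' a a' y y' b b'
    have h1 : pGen x x' a a' = pGen4 (x, x', a, a') := rfl
    have h2 : pGen y' y b' b = pGen4 (y', y, b', b) := rfl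
    rw [hτ, map_mul, mul_apply_eq_comp, h1, h2, hone, hT _ _ (hF𝒜 _), i.inner_map_map, hFE,
      flip4_involutive]
    change inner ℂ ξ (F y y' b b' (E x x' a a' ξ)) = _
    rw [(hEF x x' a a' y y' b b').eq]
    rfl
  · exact ⟨L, inferInstance, inferInstance, inferInstance, π, hfd hH,
      vectorFunctional (i ξ), fun z => rfl⟩
  · have h𝒜c : ∀ f ∈ 𝒜, ∀ g ∈ 𝒜, f * g = g * f := by
      intro f hf g hg
      have := Algebra.adjoin_le_centralizer_centralizer ℂ (Set.range F4) hf
      rw [Subalgebra.mem_centralizer_iff] at this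
      refine (this g ?_).symm
      have h2 : Algebra.adjoin ℂ (Set.range F4) ≤ Subalgebra.centralizer ℂ (Set.range F4) := by
        refine Algebra.adjoin_le ?_
        rintro _ ⟨q, rfl⟩
        change F4 q ∈ Subalgebra.centralizer ℂ (Set.range F4)
        rw [Subalgebra.mem_centralizer_iff]
        rintro _ ⟨q', rfl⟩
        exact hFF _ _ _ _ _ _ _ _
      exact h2 hg
    let ev : (H →L[ℂ] H) →ₗ[ℂ] L :=
      i.toLinearMap ∘ₗ (ContinuousLinearMap.apply ℂ H ξ).toLinearMap
    let M₀ : Submodule ℂ L := (Subalgebra.toSubmodule 𝒜).map ev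
    have hM₀ : ∀ l ∈ M₀, ∃ f ∈ 𝒜, i (f ξ) = l := fun l hl => by
      obtain ⟨f, hf, rfl⟩ := hl
      exact ⟨f, hf, rfl⟩
    have hM₀' : ∀ f ∈ 𝒜, i (f ξ) ∈ M₀ := fun f hf => ⟨f, hf, rfl⟩
    -- The whole of π need not be commutative: only on the closed cyclic space is C_X known to act
    -- through the commutative algebra 𝒜.
    let M : Submodule ℂ L := M₀.topologicalClosure
    have hMc : IsClosed (M : Set L) := M₀.isClosed_topologicalClosure
    have : CompleteSpace M := hMc.completeSpace_coe
    have hinv : ∀ z, ∀ m ∈ M, π z m ∈ M := by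
      intro z
      have h1 : ∀ m ∈ M₀, π z m ∈ M := by
        intro m hm
        obtain ⟨f, hf, rfl⟩ := hM₀ m hm
        refine cDense_dense.induction (P := fun z => π z (i (f ξ)) ∈ M) ?_ ?_ z
        · intro z hz
          obtain ⟨g, hg, hg'⟩ := hgen z hz
          rw [hg' f hf]
          exact M₀.le_topologicalClosure (hM₀' (f * g) (mul_mem hf hg))
        · have : Continuous π := map_continuous π
          exact hMc.preimage (this.clm_apply continuous_const)
      intro m hm
      have h2 : M₀.topologicalClosure ≤ M.comap (π z).toLinearMap :=
        M₀.topologicalClosure_minimal (fun m hm => h1 m hm) (hMc.preimage (π z).continuous)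
      exact h2 hm
    obtain ⟨π', hπ'⟩ := exists_restrict_rep π M hinv
    have hiξ : i ξ ∈ M := M₀.le_topologicalClosure (hM₀' 1 (one_mem _))
    refine ⟨M, inferInstance, inferInstance, inferInstance, π', fun z w => ?_,
      vectorFunctional ⟨i ξ, hiξ⟩, fun z => ?_⟩
    · have hcomm' : ∀ z ∈ cDense X, ∀ w ∈ cDense X, π' z * π' w = π' w * π' z := by
        intro z hz w hw
        obtain ⟨g, hg, hg'⟩ := hgen z hz
        obtain ⟨k, hk, hk'⟩ := hgen w hw
        ext1 m
        apply Subtype.ext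
        change ((π' z (π' w m) : M) : L) = (π' w (π' z m) : M)
        rw [hπ', hπ', hπ', hπ']
        refine eq_of_mem_topologicalClosure (A := π z * π w) (B := π w * π z) (fun m hm => ?_) m m.2
        obtain ⟨f, hf, rfl⟩ := hM₀ m hm
        change π z (π w (i (f ξ))) = π w (π z (i (f ξ)))
        rw [hg' f hf, hk' f hf]
        have e1 := hg' (f * k) (mul_mem hf hk)
        have e2 := hk' (f * g) (mul_mem hf hg)
        have e3 : f * k * g = f * g * k := by rw [mul_assoc, h𝒜c k hk g hg, mul_assoc]
        refine e1.trans (Eq.trans ?_ e2.symm)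
        exact congrArg (fun A : H →L[ℂ] H => i (A ξ)) e3
      exact commute_of_cDense (D := M →L[ℂ] M) π' hcomm' z w
    · rw [hτ, vectorFunctional_apply]
      change _ = inner ℂ (i ξ) ((π' z ⟨i ξ, hiξ⟩ : M) : L)
      rw [hπ']

end

/-! ### Perfection at J as saturation. -/

section

variable {X : Type} [Fintype X] [DecidableEq X]

theorem card_sq_mul_trace_mul_maxEnt
    (Γ : Matrix (X × X) (X × X) ℂ →ₗ[ℂ] Matrix (X × X) (X × X) ℂ) :
    (Fintype.card X : ℂ) ^ 2 * (Γ (maxEntMatrix X) * maxEntMatrix X).trace =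
      ∑ x, ∑ x', ∑ a, ∑ a', Γ (eps x x' ⊗ₖ eps x x') (a, a) (a', a') := by
  rcases isEmpty_or_nonempty X with hX | hX
  · simp
  have hc : (Fintype.card X : ℂ) ≠ 0 := by exact_mod_cast Fintype.card_ne_zero
  have h1 : ∀ M : Matrix (X × X) (X × X) ℂ, (Fintype.card X : ℂ) * (M * maxEntMatrix X).trace =
      ∑ a, ∑ a', M (a, a) (a', a') := by
    intro M
    simp only [Matrix.trace, Matrix.diag_apply, Matrix.mul_apply, maxEntMatrix_apply,
      Fintype.sum_prod_type, Finset.mul_sum]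
    simp
    refine Finset.sum_congr rfl fun a _ => Finset.sum_congr rfl fun b _ => ?_
    field_simp
  have h2 : ∀ p q, (Fintype.card X : ℂ) * Γ (maxEntMatrix X) p q =
      ∑ x, ∑ x', Γ (eps x x' ⊗ₖ eps x x') p q := fun p q => by
    simp only [maxEntMatrix, map_smul, map_sum, Matrix.smul_apply, Matrix.sum_apply, smul_eq_mul,
      mul_inv_cancel_left₀ hc]
  rw [sq, mul_assoc, h1]
  simp only [Finset.mul_sum, h2]
  calc _ = ∑ p : X × X, ∑ q : X × X, Γ (eps q.1 q.2 ⊗ₖ eps q.1 q.2) (p.1, p.1) (p.2, p.2) := by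
        simp only [Fintype.sum_prod_type]
    _ = ∑ q : X × X, ∑ p : X × X, Γ (eps q.1 q.2 ⊗ₖ eps q.1 q.2) (p.1, p.1) (p.2, p.2) :=
        Finset.sum_comm
    _ = _ := by simp only [Fintype.sum_prod_type]

/-- `Tr (Γ(J) J_⊥) = 0` in terms of the matrix entries of `Γ`. -/
theorem trace_maxEnt_eq_zero_iff [Nonempty X]
    {Γ : Matrix (X × X) (X × X) ℂ →ₗ[ℂ] Matrix (X × X) (X × X) ℂ}
    (hΓ : ∀ ρ, (Γ ρ).trace = ρ.trace) :
    (Γ (maxEntMatrix X) * (1 - maxEntMatrix X)).trace = 0 ↔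
      ∑ x, ∑ x', ∑ a, ∑ a', Γ (eps x x' ⊗ₖ eps x x') (a, a) (a', a') =
        (Fintype.card X : ℂ) ^ 2 := by
  have hc : (Fintype.card X : ℂ) ≠ 0 := by exact_mod_cast Fintype.card_ne_zero
  have hJ : (maxEntMatrix X).trace = 1 := by
    simp only [Matrix.trace, Matrix.diag_apply, maxEntMatrix_apply, Fintype.sum_prod_type]
    simp [hc]
  -- Tr Γ(J) = Tr J = 1, so the condition reads Tr(Γ(J) J) = 1; multiplying by |X|² clears the
  -- normalisations of both copies of J.
  rw [← card_sq_mul_trace_mul_maxEnt, mul_sub, mul_one, Matrix.trace_sub, hΓ, hJ, sub_eq_zero,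
    mul_eq_left₀ (pow_ne_zero 2 hc), eq_comm]

/-- At 0 the operator Γ(P) vanishes, and at any P other than 0 and J the factor 1 - φ₀(P) does, so J
carries the only constraint. -/
theorem isPerfect_concurrencyGame_iff [Nonempty X]
    (Γ : Matrix (X × X) (X × X) ℂ →ₗ[ℂ] Matrix (X × X) (X × X) ℂ) :
    IsPerfect Γ (concurrencyGame X X) ↔
      (Γ (maxEntMatrix X) * (1 - maxEntMatrix X)).trace = 0 := by
  constructor
  · intro h
    have := h (maxEnt X)
    rwa [concurrencyGame_isConcurrent X X] at this
  · intro h P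
    by_cases h0 : P = 0
    · subst h0
      change (Γ 0 * _).trace = 0
      simp
    · by_cases hJ : P = maxEnt X
      · subst hJ
        rw [concurrencyGame_isConcurrent X X]
        exact h
      · have : (concurrencyGame X X).toFun P = 1 := by simp [concurrencyGame, h0, hJ]
        rw [this]
        change (Γ P.1 * (1 - 1)).trace = 0
        simp

theorem IsPerfect.trace_maxEnt {φ : QuantumGame X X X X}
    {Γ : Matrix (X × X) (X × X) ℂ →ₗ[ℂ] Matrix (X × X) (X × X) ℂ}
    (h : IsPerfect Γ φ) (hφ : φ.IsConcurrent) :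
    (Γ (maxEntMatrix X) * (1 - maxEntMatrix X)).trace = 0 := by
  have := h (maxEnt X)
  rwa [hφ] at this

theorem exists_isPerfect_iff [Nonempty X]
    (Γ : Matrix (X × X) (X × X) ℂ →ₗ[ℂ] Matrix (X × X) (X × X) ℂ) :
    (∃ φ : QuantumGame X X X X, φ.IsConcurrent ∧ IsPerfect Γ φ) ↔
      IsPerfect Γ (concurrencyGame X X) :=
  ⟨fun ⟨_, hφ, h⟩ => (isPerfect_concurrencyGame_iff Γ).2 (h.trace_maxEnt hφ),
    fun h => ⟨_, concurrencyGame_isConcurrent X X, h⟩⟩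

theorem IsRepresentedBy.saturated {Γ : Matrix (X × X) (X × X) ℂ →ₗ[ℂ] Matrix (X × X) (X × X) ℂ}
    {τ : CAlg X →ₗ[ℂ] ℂ} (h : IsRepresentedBy Γ τ) (hτ : IsTracialState τ) :
    ∑ x, ∑ x', ∑ a, ∑ a', Γ (eps x x' ⊗ₖ eps x x') (a, a) (a', a') =
      (Fintype.card X : ℂ) ^ 2 := by
  rw [isRepresentedBy_iff] at h
  simp only [h, ← map_sum]
  rw [sum_pGen_mul_star, Algebra.algebraMap_eq_smul_one, map_smul, hτ.map_one, smul_eq_mul, mul_one]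

/-- A quantum commuting QNS correlation is a perfect strategy for the concurrency game if and only if
it is represented by a tracial state of `C_X`. -/
theorem IsQuantumCommuting.isPerfect_concurrencyGame_iff [Nonempty X]
    {Γ : Matrix (X × X) (X × X) ℂ →ₗ[ℂ] Matrix (X × X) (X × X) ℂ} (hΓ : IsQuantumCommuting Γ) :
    IsPerfect Γ (concurrencyGame X X) ↔
      ∃ τ : CAlg X →ₗ[ℂ] ℂ, IsTracialState τ ∧ IsRepresentedBy Γ τ := by
  obtain ⟨hQ, H, _, _, _, ξ, E, F, hξ, hE, hF, hEF, hrep⟩ := hΓ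
  rw [QNS.isPerfect_concurrencyGame_iff, trace_maxEnt_eq_zero_iff hQ.channel.tracePreserving]
  constructor
  · intro hsat
    simp only [hrep] at hsat
    obtain ⟨τ, hτ, hτ', -, -⟩ := exists_tracialState_of_saturated hξ hE hF hEF hsat
    refine ⟨τ, hτ, (isRepresentedBy_iff _ _).2 fun x x' y y' a a' b b' => ?_⟩
    rw [hrep, hτ']
  · rintro ⟨τ, hτ, h⟩
    exact h.saturated hτ

/-- Commutativity of the entries of F alone suffices, because C_X acts on the cyclic space through
the algebra they generate. -/
theorem IsLocal.exists_factorsAbelian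
    {Γ : Matrix (X × X) (X × X) ℂ →ₗ[ℂ] Matrix (X × X) (X × X) ℂ} (hΓ : IsLocal Γ)
    (hsat : ∑ x, ∑ x', ∑ a, ∑ a', Γ (eps x x' ⊗ₖ eps x x') (a, a) (a', a') =
      (Fintype.card X : ℂ) ^ 2) :
    ∃ τ : CAlg X →ₗ[ℂ] ℂ, IsTracialState τ ∧ IsRepresentedBy Γ τ ∧ FactorsAbelian τ := by
  obtain ⟨-, H, _, _, _, ξ, E, F, hξ, hE, hF, hEF, -, hFF, hrep⟩ := hΓ
  simp only [hrep] at hsat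
  obtain ⟨τ, hτ, hτ', -, hab⟩ := exists_tracialState_of_saturated hξ hE hF hEF hsat
  refine ⟨τ, hτ, (isRepresentedBy_iff _ _).2 fun x x' y y' a a' b b' => ?_, hab hFF⟩
  rw [hrep, hτ']

/-! ### Quantum correlations give finite dimensional traces. -/

section Tensor

open scoped TensorProduct

variable {H K : Type} [NormedAddCommGroup H] [InnerProductSpace ℂ H] [FiniteDimensional ℂ H]
  [NormedAddCommGroup K] [InnerProductSpace ℂ K] [FiniteDimensional ℂ K]

omit [FiniteDimensional ℂ H] [FiniteDimensional ℂ K] in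
theorem inner_map_map_of_inner {K₁ H₁ : Type} [NormedAddCommGroup H₁] [InnerProductSpace ℂ H₁]
    [NormedAddCommGroup K₁] [InnerProductSpace ℂ K₁] {f f' : H →ₗ[ℂ] H₁} {g g' : K →ₗ[ℂ] K₁}
    {A : H →ₗ[ℂ] H} {B : K →ₗ[ℂ] K} (hA : ∀ h h', inner ℂ (f h) (f' h') = inner ℂ h (A h'))
    (hB : ∀ k k', inner ℂ (g k) (g' k') = inner ℂ k (B k')) (u v : H ⊗[ℂ] K) :
    inner ℂ (TensorProduct.map f g u) (TensorProduct.map f' g' v) =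
      inner ℂ u (TensorProduct.map A B v) := by
  induction u with
  | zero => simp
  | add u u' hu hu' => rw [map_add, inner_add_left, inner_add_left, hu, hu']
  | tmul h k =>
    induction v with
    | zero => simp
    | add v v' hv hv' => rw [map_add, map_add, inner_add_right, inner_add_right, hv, hv']
    | tmul h' k' => simp [hA, hB]

/-- The double sum is ‖∑ V_p η_p‖². This makes positivity pass to E ⊗ 1 and 1 ⊗ F, since the Gram
operators can be tensored with the identity. -/
theorem inner_sum_sum_gram_nonneg {ι K₁ : Type} [Fintype ι] {H : Type} [NormedAddCommGroup H]
    [InnerProductSpace ℂ H] [NormedAddCommGroup K₁] [InnerProductSpace ℂ K₁]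
    {V : ι → (H →ₗ[ℂ] K₁)} {A : ι → ι → H →ₗ[ℂ] H}
    (hA : ∀ p q h h', inner ℂ (V p h) (V q h') = inner ℂ h (A p q h')) (η : ι → H) :
    0 ≤ ∑ p, ∑ q, inner ℂ (η p) (A p q (η q)) := by
  simp only [← hA, ← inner_sum, ← sum_inner]
  exact zero_le_inner_self _

theorem IsStochastic.tensor_one {E : X → X → X → X → (H →L[ℂ] H)} (hE : IsStochastic E) :
    IsStochastic fun x x' a a' =>
      (TensorProduct.map (E x x' a a' : H →ₗ[ℂ] H) (LinearMap.id : K →ₗ[ℂ] K)).toContinuousLinearMap where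
  positive η := by
    have : CompleteSpace H := FiniteDimensional.complete ℂ H
    obtain ⟨V, hV⟩ := exists_gram_of_positive (fun p q : X × X => E p.1 q.1 p.2 q.2) hE.positive
    exact inner_sum_sum_gram_nonneg (K₁ := PiLp 2 (fun _ : X × X => H) ⊗[ℂ] K)
      (V := fun p : X × X => TensorProduct.map (V p).toLinearMap LinearMap.id)
      (A := fun p q => TensorProduct.map (E p.1 q.1 p.2 q.2).toLinearMap LinearMap.id)
      (fun p q u v => inner_map_map_of_inner (hV p q) (fun _ _ => rfl) u v) η
  trace_eq_one x x' := by
    apply ContinuousLinearMap.coe_injective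
    apply TensorProduct.ext'
    intro u v
    have h' := congrArg (fun A : H →L[ℂ] H => A u ⊗ₜ[ℂ] v) (hE.trace_eq_one x x')
    simp only [_root_.sum_apply, TensorProduct.sum_tmul] at h'
    simp only [ContinuousLinearMap.coe_coe, _root_.sum_apply, LinearMap.coe_toContinuousLinearMap',
      TensorProduct.map_tmul, LinearMap.id_apply]
    rw [h']
    split_ifs <;> simp

theorem IsStochastic.one_tensor {F : X → X → X → X → (K →L[ℂ] K)} (hF : IsStochastic F) :
    IsStochastic fun x x' a a' =>
      (TensorProduct.map (LinearMap.id : H →ₗ[ℂ] H) (F x x' a a' : K →ₗ[ℂ] K)).toContinuousLinearMap where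
  positive η := by
    have : CompleteSpace K := FiniteDimensional.complete ℂ K
    obtain ⟨V, hV⟩ := exists_gram_of_positive (fun p q : X × X => F p.1 q.1 p.2 q.2) hF.positive
    exact inner_sum_sum_gram_nonneg (K₁ := H ⊗[ℂ] PiLp 2 (fun _ : X × X => K))
      (V := fun p : X × X => TensorProduct.map LinearMap.id (V p).toLinearMap)
      (A := fun p q => TensorProduct.map LinearMap.id (F p.1 q.1 p.2 q.2).toLinearMap)
      (fun p q u v => inner_map_map_of_inner (fun _ _ => rfl) (hV p q) u v) η
  trace_eq_one x x' := by
    apply ContinuousLinearMap.coe_injective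
    apply TensorProduct.ext'
    intro u v
    have h' := congrArg (fun A : K →L[ℂ] K => u ⊗ₜ[ℂ] A v) (hF.trace_eq_one x x')
    simp only [_root_.sum_apply, TensorProduct.tmul_sum] at h'
    simp only [ContinuousLinearMap.coe_coe, _root_.sum_apply, LinearMap.coe_toContinuousLinearMap',
      TensorProduct.map_tmul, LinearMap.id_apply]
    rw [h']
    split_ifs <;> simp

/-- E ⊗ 1 and 1 ⊗ F form a commuting pair on the finite dimensional space H ⊗ K, so the saturated
case applies directly. -/
theorem IsQuantum.exists_factorsFiniteDimensional
    {Γ : Matrix (X × X) (X × X) ℂ →ₗ[ℂ] Matrix (X × X) (X × X) ℂ} (hΓ : IsQuantum Γ)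
    (hsat : ∑ x, ∑ x', ∑ a, ∑ a', Γ (eps x x' ⊗ₖ eps x x') (a, a) (a', a') =
      (Fintype.card X : ℂ) ^ 2) :
    ∃ τ : CAlg X →ₗ[ℂ] ℂ, IsTracialState τ ∧ IsRepresentedBy Γ τ ∧ FactorsFiniteDimensional τ := by
  obtain ⟨-, H, _, _, _, K, _, _, _, ξ, E, F, hξ, hE, hF, hrep⟩ := hΓ
  have : CompleteSpace (H ⊗[ℂ] K) := FiniteDimensional.complete ℂ _
  have hmul : ∀ (A : H →ₗ[ℂ] H) (B : K →ₗ[ℂ] K),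
      (TensorProduct.map A (LinearMap.id : K →ₗ[ℂ] K)).toContinuousLinearMap *
      (TensorProduct.map (LinearMap.id : H →ₗ[ℂ] H) B).toContinuousLinearMap =
        (TensorProduct.map A B).toContinuousLinearMap := fun A B => by
    apply ContinuousLinearMap.coe_injective
    apply TensorProduct.ext'
    intro u v
    simp
  have hmul' : ∀ (A : H →ₗ[ℂ] H) (B : K →ₗ[ℂ] K),
      (TensorProduct.map (LinearMap.id : H →ₗ[ℂ] H) B).toContinuousLinearMap *
      (TensorProduct.map A (LinearMap.id : K →ₗ[ℂ] K)).toContinuousLinearMap =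
        (TensorProduct.map A B).toContinuousLinearMap := fun A B => by
    apply ContinuousLinearMap.coe_injective
    apply TensorProduct.ext'
    intro u v
    simp
  have hrep' : ∀ x x' y y' a a' b b', Γ (eps x x' ⊗ₖ eps y y') (a, b) (a', b') =
      inner ℂ ξ (((TensorProduct.map (E x x' a a' : H →ₗ[ℂ] H)
        (LinearMap.id : K →ₗ[ℂ] K)).toContinuousLinearMap *
      (TensorProduct.map (LinearMap.id : H →ₗ[ℂ] H)
        (F y y' b b' : K →ₗ[ℂ] K)).toContinuousLinearMap) ξ) := fun x x' y y' a a' b b' => by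
    rw [hrep, hmul]; rfl
  simp only [hrep'] at hsat
  obtain ⟨τ, hτ, hτ', hfd, -⟩ := exists_tracialState_of_saturated hξ (hE.tensor_one (K := K))
    (hF.one_tensor (H := H)) (fun _ _ _ _ _ _ _ _ => (hmul _ _).trans (hmul' _ _).symm) hsat
  refine ⟨τ, hτ, (isRepresentedBy_iff _ _).2 fun x x' y y' a a' b b' => ?_, hfd inferInstance⟩
  rw [hrep', hτ']

end Tensor

end

section

/-! ### Central densities of finite dimensional traces. -/

section Density

/-- A tracial state on a finite dimensional C*-algebra has a positive central density, given here
by its square root, with respect to any faithful positive trace. -/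
theorem IsTracialState.exists_density {R : Type*} [CStarAlgebra R] [FiniteDimensional ℂ R]
    {τ t : R →ₗ[ℂ] ℂ} (hτ : IsTracialState τ) (ht : ∀ x y, t (x * y) = t (y * x))
    (ht0 : ∀ x, 0 ≤ t (star x * x)) (htf : ∀ x, t (star x * x) = 0 → x = 0)
    (hts : ∀ x, t (star x) = star (t x)) :
    ∃ r : R, star r = r ∧ (∀ x, Commute r x) ∧ ∀ x, τ x = t (r * r * x) := by
  let _ := CStarAlgebra.spectralOrder R
  have _ := CStarAlgebra.spectralOrderedRing R
  have hnd : ∀ d, (∀ a, t (d * a) = 0) → d = 0 := fun d hd => by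
    have := htf (star d) (by rw [star_star]; exact hd _)
    simpa using this
  -- Faithfulness makes the form t(xy) nondegenerate, and in finite dimension it then represents
  -- every functional.
  obtain ⟨ρ, hρ⟩ : ∃ ρ, ∀ x, τ x = t (ρ * x) := by
    let B : R →ₗ[ℂ] Module.Dual ℂ R := (LinearMap.mul ℂ R).compr₂ t
    have hB : ∀ x y, B x y = t (x * y) := fun _ _ => rfl
    have hinj : Function.Injective B := by
      rw [← LinearMap.ker_eq_bot, LinearMap.ker_eq_bot']
      exact fun d hd => hnd d fun a => by rw [← hB, hd]; rfl
    obtain ⟨ρ, hρ⟩ := (LinearMap.injective_iff_surjective_of_finrank_eq_finrank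
      Subspace.dual_finrank_eq.symm).1 hinj τ
    exact ⟨ρ, fun x => by rw [← hρ, hB]⟩
  -- Against any a, the commutator of ρ and b pairs to τ(ba) - τ(ab) = 0.
  have hcomm : ∀ b, Commute ρ b := fun b => by
    refine sub_eq_zero.1 (hnd _ fun a => ?_)
    rw [sub_mul, map_sub, mul_assoc, mul_assoc, ht b, mul_assoc, ← hρ, ← hρ, hτ.trace, sub_self]
  have hsa : star ρ = ρ := by
    refine sub_eq_zero.1 (hnd _ fun a => ?_)
    rw [sub_mul, map_sub, ← hρ]
    have : star ρ * a = star (star a * ρ) := by simp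
    rw [this, hts, ht, ← hρ, hτ.map_star, star_star, sub_self]
  have hρsa : IsSelfAdjoint ρ := hsa
  -- With n the negative part of ρ, τ(n²) = t(ρ n²) = -t(n³) ≤ 0. Positivity of τ forces t(n³) = 0,
  -- and faithfulness of t then gives n = 0. The factorisation n = s* s exhibits n³ as (s n)*(s n).
  have hneg : ρ⁻ = 0 := by
    have hn : 0 ≤ ρ⁻ := CFC.negPart_nonneg ρ
    have hns : star ρ⁻ = ρ⁻ := (IsSelfAdjoint.of_nonneg hn).star_eq
    obtain ⟨s, hs⟩ := CStarAlgebra.nonneg_iff_eq_star_mul_self.1 hn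
    have h1 : τ (star ρ⁻ * ρ⁻) = - t (star (s * ρ⁻) * (s * ρ⁻)) := by
      rw [hρ, hns]
      have e1 : ρ * (ρ⁻ * ρ⁻) = -(ρ⁻ * ρ⁻ * ρ⁻) := by
        have : ρ = ρ⁺ - ρ⁻ := (CFC.posPart_sub_negPart ρ hρsa).symm
        have h0 := CFC.posPart_mul_negPart ρ
        calc ρ * (ρ⁻ * ρ⁻) = (ρ⁺ - ρ⁻) * (ρ⁻ * ρ⁻) := by rw [← this]
          _ = ρ⁺ * ρ⁻ * ρ⁻ - ρ⁻ * ρ⁻ * ρ⁻ := by rw [sub_mul, mul_assoc, mul_assoc]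
          _ = _ := by rw [h0, zero_mul, zero_sub]
      have e2 : star (s * ρ⁻) * (s * ρ⁻) = ρ⁻ * ρ⁻ * ρ⁻ := by
        calc star (s * ρ⁻) * (s * ρ⁻) = ρ⁻ * (star s * s) * ρ⁻ := by
              rw [star_mul, hns]; simp only [mul_assoc]
          _ = _ := by rw [← hs]
      rw [e1, e2, map_neg]
    have h2 := hτ.nonneg ρ⁻
    rw [h1] at h2
    have h3 := htf _ (le_antisymm (neg_nonneg.1 h2) (ht0 _))
    have h4 : star ρ⁻ * ρ⁻ = 0 := by
      rw [hns]
      calc ρ⁻ * ρ⁻ = star s * s * ρ⁻ := by rw [← hs]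
        _ = 0 := by rw [mul_assoc, h3, mul_zero]
    exact CStarRing.star_mul_self_eq_zero_iff _ |>.1 h4
  have hpos : 0 ≤ ρ := by
    rw [← CFC.posPart_sub_negPart ρ hρsa, hneg, sub_zero]
    exact CFC.posPart_nonneg ρ
  refine ⟨CFC.sqrt ρ, (IsSelfAdjoint.of_nonneg (CFC.sqrt_nonneg ρ)).star_eq,
    fun x => (hcomm x).cfcₙ_nnreal _, fun x => ?_⟩
  rw [CFC.sqrt_mul_sqrt_self ρ hpos, hρ]

end Density

/-! ### Transposition with respect to an orthonormal basis. -/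

section Transpose

variable {ι H : Type} [Fintype ι] [NormedAddCommGroup H] [InnerProductSpace ℂ H]

theorem ext_inner_basis {b : OrthonormalBasis ι ℂ H} {S T : H →L[ℂ] H}
    (h : ∀ i j, inner ℂ (b i) (S (b j)) = inner ℂ (b i) (T (b j))) : S = T := by
  apply ContinuousLinearMap.coe_injective
  refine b.toBasis.ext fun j => ?_
  apply b.repr.injective
  ext i
  simpa [b.repr_apply_apply] using h i j

theorem inner_mul_basis [CompleteSpace H] (b : OrthonormalBasis ι ℂ H) (S T : H →L[ℂ] H) (u v : H) :
    inner ℂ u ((S * T) v) = ∑ k, inner ℂ u (S (b k)) * inner ℂ (b k) (T v) := by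
  rw [mul_apply_eq_comp, ← ContinuousLinearMap.adjoint_inner_left,
    ← b.sum_inner_mul_inner]
  simp only [ContinuousLinearMap.adjoint_inner_left]

/-- The transpose of operators with respect to an orthonormal basis. -/
theorem exists_transpose [CompleteSpace H] (b : OrthonormalBasis ι ℂ H) :
    ∃ θ : (H →L[ℂ] H) →ₗ[ℂ] (H →L[ℂ] H), θ 1 = 1 ∧ (∀ S T, θ (S * T) = θ T * θ S) ∧
      (∀ T, θ (star T) = star (θ T)) ∧
      ∀ T i j, inner ℂ (b i) (θ T (b j)) = inner ℂ (b j) (T (b i)) := by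
  let θ : (H →L[ℂ] H) →ₗ[ℂ] (H →L[ℂ] H) :=
    { toFun T := ∑ i, ∑ j, inner ℂ (b j) (T (b i)) •
        ((innerSL ℂ (b j)).smulRight (b i) : H →L[ℂ] H)
      map_add' S T := by simp [add_smul, Finset.sum_add_distrib]
      map_smul' c T := by simp [mul_smul, Finset.smul_sum] }
  have hθ : ∀ T i j, inner ℂ (b i) (θ T (b j)) = inner ℂ (b j) (T (b i)) := by
    classical
    intro T i j
    have : θ T (b j) = ∑ k, inner ℂ (b j) (T (b k)) • b k := by
      simp [θ, _root_.sum_apply, orthonormal_iff_ite.1 b.orthonormal]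
    rw [this, inner_sum]
    simp [inner_smul_right, orthonormal_iff_ite.1 b.orthonormal]
  refine ⟨θ, ext_inner_basis (b := b) fun i j => ?_, fun S T => ext_inner_basis (b := b) fun i j => ?_,
    fun T => ext_inner_basis (b := b) fun i j => ?_, hθ⟩
  · classical
    rw [hθ]; simp [orthonormal_iff_ite.1 b.orthonormal, eq_comm]
  · rw [hθ, inner_mul_basis b, inner_mul_basis b]
    simp only [hθ]
    exact Finset.sum_congr rfl fun k _ => mul_comm _ _
  · rw [hθ, ContinuousLinearMap.star_eq_adjoint, ContinuousLinearMap.star_eq_adjoint,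
      ContinuousLinearMap.adjoint_inner_right, ContinuousLinearMap.adjoint_inner_right,
      ← inner_conj_symm, ← inner_conj_symm (θ T (b i)), hθ]

end Transpose

/-! ### Representations of C_X as stochastic matrices; finite dimensional traces are quantum. -/

variable {X : Type} [Fintype X] [DecidableEq X]

theorem isStochastic_of_gram {H : Type} [NormedAddCommGroup H] [InnerProductSpace ℂ H]
    [CompleteSpace H] {E : X → X → X → X → (H →L[ℂ] H)} (A : X → X → X → (H →L[ℂ] H))
    (hA : ∀ x x' a a', E x x' a a' = ∑ y, star (A y x a) * A y x' a')
    (htr : ∀ x x', ∑ a, E x x' a a = if x = x' then 1 else 0) : IsStochastic E where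
  trace_eq_one := htr
  positive η := by
    have : ∀ p q : X × X, inner ℂ (η p) (E p.1 q.1 p.2 q.2 (η q)) =
        ∑ y, inner ℂ (A y p.1 p.2 (η p)) (A y q.1 q.2 (η q)) := fun p q => by
      rw [hA, _root_.sum_apply, inner_sum]
      refine Finset.sum_congr rfl fun y _ => ?_
      rw [mul_apply_eq_comp, ContinuousLinearMap.star_eq_adjoint,
        ContinuousLinearMap.adjoint_inner_right]
    simp only [this]
    rw [Finset.sum_congr rfl fun p _ => Finset.sum_comm, Finset.sum_comm]
    refine Finset.sum_nonneg fun y _ => ?_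
    simp only [← inner_sum, ← sum_inner]
    exact zero_le_inner_self _

/-- Positivity of the matrix (p_{x,x',a,a'}) witnessed by elements of C_X alone, so that it survives
any representation of C_X. Fixing c is where a nonempty X is needed later. -/
theorem pGen_eq_sum_star_mul (c x x' a a' : X) :
    pGen x x' a a' = ∑ y, star (pGen y x c a) * pGen y x' c a' := by
  simp only [star_pGen, sum_pGen_mul_pGen]

theorem isStochastic_rep [Nonempty X] {H : Type} [NormedAddCommGroup H] [InnerProductSpace ℂ H]
    [CompleteSpace H] (π : CAlg X →⋆ₐ[ℂ] (H →L[ℂ] H)) :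
    IsStochastic fun x x' a a' => π (pGen x x' a a') := by
  obtain ⟨c⟩ := ‹Nonempty X›
  refine isStochastic_of_gram (fun y x a => π (pGen y x c a)) (fun x x' a a' => ?_) fun x x' => ?_
  · simp only [← map_star, ← map_mul, ← map_sum, ← pGen_eq_sum_star_mul]
  · rw [← map_sum, sum_pGen_diag]
    split_ifs <;> simp

/-- The opposite of a representation of `C_X` gives a stochastic operator matrix. -/
theorem isStochastic_opposite [Nonempty X] {H : Type} [NormedAddCommGroup H]
    [InnerProductSpace ℂ H] [CompleteSpace H] (π : CAlg X →ₗ[ℂ] (H →L[ℂ] H)) (h1 : π 1 = 1)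
    (hmul : ∀ z w, π (z * w) = π w * π z) (hstar : ∀ z, π (star z) = star (π z)) :
    IsStochastic fun x x' a a' => π (pGen x' x a' a) := by
  obtain ⟨c⟩ := ‹Nonempty X›
  refine isStochastic_of_gram (fun y x a => star (π (pGen y x c a))) (fun x x' a a' => ?_)
    fun x x' => ?_
  · rw [pGen_eq_sum_star_mul c, map_sum]
    exact Finset.sum_congr rfl fun y _ => by rw [hmul, hstar, star_star]
  · rw [← map_sum, sum_pGen_diag]
    split_ifs <;> simp_all

open scoped TensorProduct in
-- On the range of π the trace is Tr(r² ·) with r central, and Tr(r S r T) = ⟨(S ⊗ Tᵗ) ξ, ξ⟩ for ξ =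
-- ∑ r b_i ⊗ b_i. The transpose reverses products, which is why the second stochastic matrix uses
-- flipped indices.
theorem FactorsFiniteDimensional.isQuantum [Nonempty X]
    {Γ : Matrix (X × X) (X × X) ℂ →ₗ[ℂ] Matrix (X × X) (X × X) ℂ} (hΓ : IsQNS Γ)
    {τ : CAlg X →ₗ[ℂ] ℂ} (hτ : IsTracialState τ) (hrep : IsRepresentedBy Γ τ)
    (hfd : FactorsFiniteDimensional τ) : IsQuantum Γ := by
  obtain ⟨H, _, _, _, π, _, σ, hσ⟩ := hfd
  let R : StarSubalgebra ℂ (H →L[ℂ] H) := π.range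
  have hRfd : FiniteDimensional ℂ R :=
    inferInstanceAs (FiniteDimensional ℂ (Subalgebra.toSubmodule R.toSubalgebra))
  -- Closedness makes the range a C*-algebra. The functional σ is known to be a tracial state only
  -- there, so the density is sought in R and compared with the trace of H restricted to R.
  have hRc : IsClosed (R : Set (H →L[ℂ] H)) :=
    (Subalgebra.toSubmodule R.toSubalgebra).closed_of_finiteDimensional
  let b := stdOrthonormalBasis ℂ H
  let t : (H →L[ℂ] H) →ₗ[ℂ] ℂ := LinearMap.trace ℂ H ∘ₗ ContinuousLinearMap.coeLM ℂ
  have ht : ∀ T, t T = ∑ i, inner ℂ (b i) (T (b i)) := fun T =>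
    LinearMap.trace_eq_sum_inner (T : H →ₗ[ℂ] H) b
  have htt : ∀ S T, t (S * T) = t (T * S) := fun S T =>
    LinearMap.trace_mul_comm ℂ (S : H →ₗ[ℂ] H) (T : H →ₗ[ℂ] H)
  have htn : ∀ T, t (star T * T) = ((∑ i, ‖T (b i)‖ ^ 2 : ℝ) : ℂ) := fun T => by
    rw [ht]
    push_cast
    refine Finset.sum_congr rfl fun i _ => ?_
    change inner ℂ (b i) (star T (T (b i))) = _
    rw [ContinuousLinearMap.star_eq_adjoint, ContinuousLinearMap.adjoint_inner_right,
      inner_self_eq_norm_sq_to_K]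
    rfl
  let τ' : R →ₗ[ℂ] ℂ := σ ∘ₗ (Subalgebra.toSubmodule R.toSubalgebra).subtype
  have hτ' : ∀ x : R, τ' x = σ x := fun _ => rfl
  have hτs : IsTracialState τ' := by
    refine ⟨?_, ?_, ?_⟩
    · rw [hτ']
      have := hσ 1
      rw [hτ.map_one, map_one] at this
      exact this.symm
    · rintro ⟨_, z, rfl⟩
      have := hτ.nonneg z
      rwa [hσ, map_mul, map_star] at this
    · rintro ⟨_, z, rfl⟩ ⟨_, w, rfl⟩
      have := hτ.trace z w
      rwa [hσ, hσ, map_mul π, map_mul π] at this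
  let t' : R →ₗ[ℂ] ℂ := t ∘ₗ (Subalgebra.toSubmodule R.toSubalgebra).subtype
  obtain ⟨r, hrs, hrc, hr⟩ := hτs.exists_density (t := t') (fun x y => htt _ _)
    (fun x => by
      change 0 ≤ t (star (x : H →L[ℂ] H) * x)
      rw [htn]
      exact Complex.zero_le_real.2 (Finset.sum_nonneg fun i _ => sq_nonneg _))
    (fun x hx => by
      change t (star (x : H →L[ℂ] H) * x) = 0 at hx
      rw [htn] at hx
      have hx' : ∑ i, ‖(x : H →L[ℂ] H) (b i)‖ ^ 2 = 0 := by exact_mod_cast hx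
      rw [Finset.sum_eq_zero_iff_of_nonneg fun i _ => sq_nonneg _] at hx'
      apply Subtype.ext
      apply ContinuousLinearMap.coe_injective
      refine b.toBasis.ext fun i => ?_
      have := hx' i (Finset.mem_univ i)
      rw [sq_eq_zero_iff, norm_eq_zero] at this
      simpa using this)
    (fun x => by
      change t (star (x : H →L[ℂ] H)) = star (t x)
      rw [ht, ht, star_sum]
      refine Finset.sum_congr rfl fun i _ => ?_
      rw [ContinuousLinearMap.star_eq_adjoint, ContinuousLinearMap.adjoint_inner_right,
        ← inner_conj_symm]
      rfl)
  obtain ⟨θ, hθ1, hθm, hθs, hθ⟩ := exists_transpose b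
  let r₀ : H →L[ℂ] H := r
  have hr₀ : ∀ u v, inner ℂ (r₀ u) v = inner ℂ u (r₀ v) := fun u v => by
    have : star r₀ = r₀ := congrArg Subtype.val hrs
    conv_rhs => rw [← this]
    rw [ContinuousLinearMap.star_eq_adjoint, ContinuousLinearMap.adjoint_inner_right]
  let ξ : H ⊗[ℂ] H := ∑ i, r₀ (b i) ⊗ₜ[ℂ] b i
  have hξ : ∀ z w, inner ℂ ξ (TensorProduct.map (π z : H →ₗ[ℂ] H) (θ (π w) : H →ₗ[ℂ] H) ξ) =
      τ (z * w) := by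
    intro z w
    -- Centrality of r in R gathers both copies of r to the left.
    have h1 : r₀ * (π z * r₀) = r₀ * r₀ * π z := by
      have := congrArg Subtype.val (hrc ⟨π z, z, rfl⟩).eq
      change r₀ * π z = π z * r₀ at this
      rw [← this, mul_assoc]
    have h2 : τ (z * w) = t (r₀ * r₀ * (π z * π w)) := by
      have := hr ⟨π (z * w), z * w, rfl⟩
      rw [hσ]
      refine Eq.trans this ?_
      rw [← map_mul]
      rfl
    have h3 : r₀ * r₀ * (π z * π w) = r₀ * (π z * r₀) * π w := by rw [h1, mul_assoc (r₀ * r₀)]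
    rw [h2, h3, ht]
    simp only [ξ, map_sum, sum_inner, inner_sum, TensorProduct.map_tmul,
      ContinuousLinearMap.coe_coe, TensorProduct.inner_tmul, hθ]
    rw [Finset.sum_comm]
    refine Finset.sum_congr rfl fun i _ => ?_
    rw [inner_mul_basis b]
    refine Finset.sum_congr rfl fun j _ => ?_
    rw [hr₀]
    rfl
  refine ⟨hΓ, H, inferInstance, inferInstance, inferInstance, H, inferInstance, inferInstance,
    inferInstance, ξ, _, _, ?_, isStochastic_rep π,
    isStochastic_opposite (θ ∘ₗ π.toAlgHom.toLinearMap) ?_ ?_ ?_, ?_⟩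
  · have h1 := hξ 1 1
    rw [mul_one, hτ.map_one, map_one, hθ1] at h1
    have h2 : inner ℂ ξ (TensorProduct.map ((1 : H →L[ℂ] H) : H →ₗ[ℂ] H)
        ((1 : H →L[ℂ] H) : H →ₗ[ℂ] H) ξ) = inner ℂ ξ ξ := congrArg _ (by
      change TensorProduct.map LinearMap.id LinearMap.id ξ = ξ
      rw [TensorProduct.map_id]; rfl)
    have h3 : ((‖ξ‖ : ℝ) : ℂ) ^ 2 = 1 :=
      (inner_self_eq_norm_sq_to_K (𝕜 := ℂ) ξ).symm.trans (h2.symm.trans h1)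
    norm_cast at h3
    exact (pow_eq_one_iff_of_nonneg (norm_nonneg ξ) two_ne_zero).1 h3
  · change θ (π 1) = 1
    rw [map_one, hθ1]
  · intro z w
    change θ (π (z * w)) = θ (π w) * θ (π z)
    rw [map_mul, hθm]
  · intro z
    change θ (π (star z)) = star (θ (π z))
    rw [map_star, hθs]
  · intro x x' y y' a a' b b'
    rw [(isRepresentedBy_iff _ _).1 hrep]
    exact (hξ _ _).symm

end

/-! ### The GNS construction; abelian traces are local. -/

section

open UniformSpace in
/-- The Gelfand-Naimark-Segal construction for a positive functional on a *-algebra whose left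
multiplications are bounded. -/
theorem exists_gns {R : Type} [Ring R] [StarRing R] [Algebra ℂ R] [StarModule ℂ R]
    (φ : R →ₗ[ℂ] ℂ) (hstar : ∀ x, φ (star x) = star (φ x)) (hpos : ∀ x, 0 ≤ φ (star x * x))
    (hbdd : ∀ a, ∃ C : ℝ, 0 ≤ C ∧
      ∀ x, φ (star (a * x) * (a * x)) ≤ ((C ^ 2 : ℝ) : ℂ) * φ (star x * x)) :
    ∃ (H : Type) (_ : NormedAddCommGroup H) (_ : InnerProductSpace ℂ H) (_ : CompleteSpace H)
      (ξ : H) (π : R →⋆ₐ[ℂ] (H →L[ℂ] H)), ∀ a, inner ℂ ξ (π a ξ) = φ a := by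
  let core : PreInnerProductSpace.Core ℂ R :=
    { inner a b := φ (star a * b)
      conj_inner_symm a b := by
        have := hstar (star b * a)
        rw [star_mul, star_star] at this
        exact this.symm
      re_inner_nonneg a := (Complex.nonneg_iff.1 (hpos a)).1
      add_left a b c := by rw [star_add, add_mul, map_add]
      smul_left a b r := by simp }
  -- The form may be degenerate; the Hausdorff completion taken below removes its null vectors.
  let _ : SeminormedAddCommGroup R := InnerProductSpace.Core.toSeminormedAddCommGroup (c := core)
  let _ : InnerProductSpace ℂ R := InnerProductSpace.ofCore core
  have hinner : ∀ a b : R, inner ℂ a b = φ (star a * b) := fun _ _ => rfl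
  have hnorm : ∀ a : R, ((‖a‖ ^ 2 : ℝ) : ℂ) = φ (star a * a) := fun a => by
    rw [← hinner, inner_self_eq_norm_sq_to_K]
    push_cast
    rfl
  choose C hC0 hC using hbdd
  let l : R → (R →L[ℂ] R) := fun a => (LinearMap.mulLeft ℂ a).mkContinuous (C a) fun x => by
    rw [← sq_le_sq₀ (norm_nonneg _) (mul_nonneg (hC0 a) (norm_nonneg x)), mul_pow]
    have := hC a x
    rw [← hnorm, ← hnorm, ← Complex.ofReal_mul, Complex.real_le_real] at this
    exact this
  have hl : ∀ a x, l a x = a * x := fun _ _ => rfl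
  let π : R →⋆ₐ[ℂ] (Completion R →L[ℂ] Completion R) :=
    { toFun a := (l a).completion
      map_one' := by
        ext c
        induction c using Completion.induction_on with
        | hp => apply isClosed_eq <;> fun_prop
        | ih c => simp [hl]
      map_mul' a b := by
        ext c
        induction c using Completion.induction_on with
        | hp => apply isClosed_eq <;> fun_prop
        | ih c => simp [hl, mul_assoc]
      map_zero' := by
        ext c
        induction c using Completion.induction_on with
        | hp => apply isClosed_eq <;> fun_prop
        | ih c =>
          rw [ContinuousLinearMap.completion_apply_coe, hl, zero_mul]
          exact Completion.coe_zero
      map_add' a b := by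
        ext c
        induction c using Completion.induction_on with
        | hp => apply isClosed_eq <;> fun_prop
        | ih c => simp [hl, add_mul, Completion.coe_add]
      commutes' r := by
        ext c
        induction c using Completion.induction_on with
        | hp => apply isClosed_eq <;> fun_prop
        | ih c => simp [hl, Algebra.algebraMap_eq_smul_one]
      map_star' a := by
        refine (ContinuousLinearMap.eq_adjoint_iff _ _).mpr fun x y => ?_
        induction x, y using Completion.induction_on₂ with
        | hp => apply isClosed_eq <;> fun_prop
        | ih x y => simp [hl, hinner, mul_assoc] }
  refine ⟨Completion R, inferInstance, inferInstance, inferInstance, ((1 : R) : Completion R), π,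
    fun a => ?_⟩
  have h1 : π a ((1 : R) : Completion R) = ((a : R) : Completion R) := by
    change (l a).completion _ = _
    simp [hl]
  rw [h1, Completion.inner_coe, hinner, star_one, one_mul]

/-- Apply τ to w* z* z w ≤ ‖z‖² w* w. It supplies the boundedness required by `exists_gns`. -/
theorem IsTracialState.map_star_mul_mul_le {𝒜 : Type*} [CStarAlgebra 𝒜] {τ : 𝒜 →ₗ[ℂ] ℂ}
    (hτ : IsTracialState τ) (z w : 𝒜) :
    τ (star (z * w) * (z * w)) ≤ ((‖z‖ ^ 2 : ℝ) : ℂ) * τ (star w * w) := by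
  let _ := CStarAlgebra.spectralOrder 𝒜
  have _ := CStarAlgebra.spectralOrderedRing 𝒜
  have h1 : star w * (star z * z) * w ≤ ‖star z * z‖ • (star w * w) :=
    CStarAlgebra.star_left_conjugate_le_norm_smul
  obtain ⟨s, hs⟩ := CStarAlgebra.nonneg_iff_eq_star_mul_self.1 (sub_nonneg.2 h1)
  have h2 := hτ.nonneg s
  rw [← hs, map_sub, sub_nonneg, CStarRing.norm_star_mul_self, ← sq, ← Complex.coe_smul, map_smul,
    smul_eq_mul] at h2
  simpa [mul_assoc] using h2

variable {X : Type} [Fintype X] [DecidableEq X]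

/-- The functional σ is merely linear, so τ has to be turned into a vector state by GNS. This is
done on the range of π, which is commutative and, unlike `CAlg X`, lives in `Type`. Positivity and
boundedness are pulled back to C_X along the surjection onto the range. By commutativity the
resulting representation is also its own opposite, so it yields both E and F. -/
theorem FactorsAbelian.isLocal [Nonempty X]
    {Γ : Matrix (X × X) (X × X) ℂ →ₗ[ℂ] Matrix (X × X) (X × X) ℂ} (hΓ : IsQNS Γ)
    {τ : CAlg X →ₗ[ℂ] ℂ} (hτ : IsTracialState τ) (hrep : IsRepresentedBy Γ τ)
    (hab : FactorsAbelian τ) : IsLocal Γ := by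
  obtain ⟨H, _, _, _, π, hπ, σ, hσ⟩ := hab
  let R : StarSubalgebra ℂ (H →L[ℂ] H) := π.range
  let φ : R →ₗ[ℂ] ℂ := σ ∘ₗ (Subalgebra.toSubmodule R.toSubalgebra).subtype
  let ρ : CAlg X →⋆ₐ[ℂ] R := π.rangeRestrict
  have hρ : Function.Surjective ρ := by
    rintro ⟨_, z, rfl⟩
    exact ⟨z, rfl⟩
  have hφ : ∀ z, φ (ρ z) = τ z := fun z => (hσ z).symm
  have hcomm : ∀ z w, ρ z * ρ w = ρ w * ρ z := fun z w => Subtype.ext (hπ z w)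
  obtain ⟨K, _, _, _, ξ, κ, hκ⟩ := exists_gns φ
    (fun x => by
      obtain ⟨z, rfl⟩ := hρ x
      rw [← map_star, hφ, hφ, hτ.map_star])
    (fun x => by
      obtain ⟨z, rfl⟩ := hρ x
      rw [← map_star, ← map_mul, hφ]
      exact hτ.nonneg z)
    (fun a => by
      obtain ⟨z, rfl⟩ := hρ a
      refine ⟨‖z‖, norm_nonneg z, fun x => ?_⟩
      obtain ⟨w, rfl⟩ := hρ x
      rw [← map_mul, ← map_star, ← map_star, ← map_mul, ← map_mul, hφ, hφ]
      exact hτ.map_star_mul_mul_le z w)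
  let θ : CAlg X →⋆ₐ[ℂ] (K →L[ℂ] K) := κ.comp ρ
  have hθ : ∀ z, inner ℂ ξ (θ z ξ) = τ z := fun z => (hκ _).trans (hφ z)
  have hθc : ∀ z w, Commute (θ z) (θ w) := fun z w => by
    change κ (ρ z) * κ (ρ w) = κ (ρ w) * κ (ρ z)
    rw [← map_mul, hcomm, map_mul]
  refine ⟨hΓ, K, inferInstance, inferInstance, inferInstance, ξ, _, _, ?_, isStochastic_rep θ,
    isStochastic_opposite θ.toAlgHom.toLinearMap (map_one θ)
      (fun z w => (map_mul θ z w).trans (hθc z w)) (fun z => map_star θ z),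
    fun _ _ _ _ _ _ _ _ => hθc _ _, fun _ _ _ _ _ _ _ _ => hθc _ _,
    fun _ _ _ _ _ _ _ _ => hθc _ _, fun x x' y y' a a' b b' => ?_⟩
  · have h1 := hθ 1
    rw [map_one, hτ.map_one, one_apply_eq_self] at h1
    have h3 : ((‖ξ‖ : ℝ) : ℂ) ^ 2 = 1 := (inner_self_eq_norm_sq_to_K (𝕜 := ℂ) ξ).symm.trans h1
    norm_cast at h3
    exact (pow_eq_one_iff_of_nonneg (norm_nonneg ξ) two_ne_zero).1 h3
  · rw [(isRepresentedBy_iff _ _).1 hrep, ← hθ, map_mul]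
    rfl

end

end QNS

end

/-! ### The main theorem. -/

theorem theorem4p3 {X : Type} [Fintype X] [DecidableEq X] [Nonempty X]
    (Γ : Matrix (X × X) (X × X) ℂ →ₗ[ℂ] Matrix (X × X) (X × X) ℂ)
    (hΓ : QNS.IsQuantumCommuting Γ) :
    ((∃ φ : QNS.QuantumGame X X X X, φ.IsConcurrent ∧ QNS.IsPerfect Γ φ) ↔
      ∃ τ : QNS.CAlg X →ₗ[ℂ] ℂ, QNS.IsTracialState τ ∧ QNS.IsRepresentedBy Γ τ) ∧
    (QNS.IsPerfect Γ (QNS.concurrencyGame X X) ↔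
      ∃ τ : QNS.CAlg X →ₗ[ℂ] ℂ, QNS.IsTracialState τ ∧ QNS.IsRepresentedBy Γ τ) ∧
    ∀ φ : QNS.QuantumGame X X X X, φ.IsConcurrent → QNS.IsPerfect Γ φ →
      (QNS.IsQuantum Γ ↔
        ∃ τ : QNS.CAlg X →ₗ[ℂ] ℂ, QNS.IsTracialState τ ∧ QNS.IsRepresentedBy Γ τ ∧
          QNS.FactorsFiniteDimensional τ) ∧
      (QNS.IsLocal Γ ↔
        ∃ τ : QNS.CAlg X →ₗ[ℂ] ℂ, QNS.IsTracialState τ ∧ QNS.IsRepresentedBy Γ τ ∧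
          QNS.FactorsAbelian τ) := by
  refine ⟨(QNS.exists_isPerfect_iff Γ).trans hΓ.isPerfect_concurrencyGame_iff,
    hΓ.isPerfect_concurrencyGame_iff, fun φ hφ hperf => ?_⟩
  have hsat := (QNS.trace_maxEnt_eq_zero_iff hΓ.1.channel.tracePreserving).1
    (hperf.trace_maxEnt hφ)
  exact ⟨⟨fun h => h.exists_factorsFiniteDimensional hsat,
      fun ⟨_, hτ, hrep, hfd⟩ => hfd.isQuantum hΓ.1 hτ hrep⟩,
    ⟨fun h => h.exists_factorsAbelian hsat,
      fun ⟨_, hτ, hrep, hab⟩ => hab.isLocal hΓ.1 hτ hrep⟩⟩
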